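/- **Model.** A streaming interactive proof (SIP) with $d$ rounds, for streams $\sigma=\langle a_1,\dots,a_n\rangle$ over $[m]$, has a verifier $V$ with a finite set of memory states and an unbounded prover $P$ who knows $\sigma$. $V$ tosses its private coins before the stream starts (they are kept in its memory), reads $\sigma$ once, symbol by symbol, and then interacts with $P$ for $d$ rounds; in each round $V$ sends a message of prescribed bit length and $P$ replies with a message of prescribed bit length. $V$ produces and consumes messages bit by bit. At the end $V$ outputs a number or $\bot$. The SIP *computes $f$ with completeness error $\varepsilon_c$ and soundness error $\varepsilon_s$* if some prover makes $V$ output $f(\sigma)$ with probability at least $1-\varepsilon_c$ for every $\sigma$, and for every $\sigma$ and every prover $V$ outputs a value outside $\{f(\sigma),\bot\}$ with probability at most $\varepsilon_s$. The *communication* is the total number of bits exchanged; the *space* is the number of bits of $V$'s memory, $\lceil\log_2 \#\text{states}\rceil$. The verifier may depend on $m$ and $n$. *Update time.* While reading the stream, $V$ holds registers with elements of finite fields, read-only index registers, and the current position $k$ in the stream (all counted in the space). For each symbol $a_k$ it executes a fixed straight-line program whose instructions each take one unit of time: load a constant of a field; add or multiply two field elements; load a binary digit of $a_k$ into a field register;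 load an entry $G_{\alpha,k}$ of a matrix over one of the fields that was agreed upon before the stream starts, where $\alpha$ is the content of an index register; and, once per symbol, increment $k$. Each field has at most $(\lceil\log_2 m\rceil+1)^{C}$ elements. **Theorem.** There is an absolute constant $C$ such that for all integers $m\ge 2$, $n\ge 1$ with $(m,n)\ne(2,1)$ there is an SIP with $\lceil\log_2 m\rceil$ rounds that computes the number $F_0(\sigma)=|\{a_1,\dots,a_n\}|$ of distinct elements of streams $\sigma$ of length $n$ over $[m]$ exactly, with completeness error $1/6$ and soundness error $1/3$, in which (with $\log=\log_2$) - the communication is at most $C\,\log m\,\bigl(\log n+\log^3 m\,(\log\log m)^2\bigr)$ bits, - the space of the verifier is at most $C\,\log m\,\bigl(\log n+\log m\,\log\log m\bigr)$ bits, and - the update time of the verifier per symbol is at most $C\,\log^2 m$. -/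

import Mathlib

/-- The number `F₀` of distinct elements of the stream `σ = ⟨σ 0, …, σ (n-1)⟩` over the universe
`[m]` (modelled as `Fin m`). -/
def distinctElements {m n : ℕ} (σ : Fin n → Fin m) : ℕ :=
  (Finset.univ.image σ).card

/-! ### Streaming interactive proofs -/

/-- The verifier of a streaming interactive proof with `d` rounds, for streams over `[m]`.

The verifier is a finite-state one-pass machine.  All its private coins are tossed before the
stream starts and have to be kept in the memory (so they are charged to the space).  It reads the
stream symbol by symbol.  Afterwards there are `d` rounds; in round `j` the verifier sends
`vlen j` bits to the prover, who replies with `plen j` bits.  The verifier produces and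
consumes messages one bit at a time: it has no other storage than its current state, and its
transitions have no access to a clock.  Finally it outputs a number, or `none` (rejection). -/
structure SIPVerifier (m d : ℕ) where
  /-- memory configurations -/
  State : Type
  finite_state : Finite State
  /-- the private random choices -/
  init : PMF State
  /-- processing of one stream symbol -/
  update : State → Fin m → State
  /-- number of bits sent by the verifier in each round -/
  vlen : Fin d → ℕ
  /-- number of bits sent by the prover in each round -/
  plen : Fin d → ℕ
  /-- produce the next bit of a message to the prover -/
  send : State → Bool × State
  /-- consume the next bit of a message of the prover -/
  recv : State → Bool → State
  /-- the final answer; `none` stands for rejection -/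
  output : State → Option ℕ

namespace SIPVerifier

variable {m d : ℕ} (V : SIPVerifier m d)

/-- A strategy of the (computationally unbounded) prover for the interaction that follows a given
stream: its message in round `j`, as a function of all bits received from the verifier so far. -/
def Strategy : Type := (j : Fin d) → List Bool → (Fin (V.plen j) → Bool)

/-- The verifier sends `k` bits. -/
def emit : ℕ → V.State → List Bool × V.State
  | 0, s => ([], s)
  | k + 1, s =>
    let e := V.send s
    let r := emit k e.2
    (e.1 :: r.1, r.2)

/-- One round.  A configuration consists of the bits sent by the verifier so far and of the
verifier's state. -/
def round (P : V.Strategy) (c : List Bool × V.State) (j : Fin d) : List Bool × V.State :=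
  let e := V.emit (V.vlen j) c.2
  let h := c.1 ++ e.1
  (h, (List.ofFn (P j h)).foldl V.recv e.2)

/-- The state of the verifier after it has read the whole stream. -/
def readStream {n : ℕ} (σ : Fin n → Fin m) (s : V.State) : V.State :=
  (List.ofFn σ).foldl V.update s

/-- The answer of the verifier with initial state `s` on the stream `σ`, when it interacts with
the prover strategy `P`. -/
def answer {n : ℕ} (σ : Fin n → Fin m) (P : V.Strategy) (s : V.State) : Option ℕ :=
  V.output (((List.finRange d).foldl (V.round P) ([], V.readStream σ s)).2)

/-- The distribution of the answer over the private coins of the verifier. -/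
noncomputable def answerDist {n : ℕ} (σ : Fin n → Fin m) (P : V.Strategy) : PMF (Option ℕ) :=
  V.init.map (V.answer σ P)

/-- `V` is the verifier of a streaming interactive proof that computes `f` on streams of length
`n`, with completeness error `εc` and soundness error `εs`: some prover makes the verifier output
the correct value with probability at least `1 - εc` on every stream, and no prover makes it
output an incorrect value with probability more than `εs` on any stream. -/
structure Computes {n : ℕ} (f : (Fin n → Fin m) → ℕ) (εc εs : ENNReal) : Prop where
  complete : ∃ P : (Fin n → Fin m) → V.Strategy, ∀ σ, 1 - εc ≤ V.answerDist σ (P σ) (some (f σ))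
  sound : ∀ (σ : Fin n → Fin m) (P : V.Strategy),
    (V.answerDist σ P).toOuterMeasure {o | o ≠ none ∧ o ≠ some (f σ)} ≤ εs

/-- Working memory of the verifier, in bits. -/
noncomputable def space : ℕ := Nat.clog 2 (Nat.card V.State)

/-- Total number of bits exchanged. -/
def communication : ℕ := ∑ j, (V.vlen j + V.plen j)

end SIPVerifier

/-! ### Unit-cost processing of stream symbols -/

/-- The instructions that may be executed on a stream symbol `a`, each at unit cost.  The
machine has, for every `i`, `reg i` registers that hold elements of the field `K i`, and
`idx` index registers. -/
inductive UpdateInstr {f : ℕ} (K : Fin f → Type) (reg : Fin f → ℕ) (idx : ℕ) : Type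
  /-- `dst := c` for a constant `c` of the field -/
  | const (i : Fin f) (dst : Fin (reg i)) (c : K i)
  /-- `dst := x + y` in the field `K i` -/
  | add (i : Fin f) (dst x y : Fin (reg i))
  /-- `dst := x * y` in the field `K i` -/
  | mul (i : Fin f) (dst x y : Fin (reg i))
  /-- `dst :=` the `j`-th binary digit of the current symbol, as an element of `K i` -/
  | digit (i : Fin f) (dst : Fin (reg i)) (j : ℕ)
  /-- `dst := G i α k` where `G i` is the matrix over `K i` agreed upon before the stream starts,
  `α` is the content of the index register `x` and `k` is the position of the current symbol -/
  | entry (i : Fin f) (dst : Fin (reg i)) (x : Fin idx)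

/-- A machine that processes streams of length `n` over `[m]` by means of a fixed straight-line
program, executed once for every symbol, over finitely many finite fields. -/
structure UpdateMachine (n : ℕ) where
  /-- number of finite fields in use -/
  f : ℕ
  K : Fin f → Type
  field : ∀ i, Field (K i)
  finite : ∀ i, Finite (K i)
  /-- number of registers over each of the fields -/
  reg : Fin f → ℕ
  /-- number of index registers -/
  idx : ℕ
  /-- number of rows of the matrices agreed upon in advance -/
  rows : ℕ
  /-- the matrices agreed upon in advance; their columns correspond to stream positions -/
  G : ∀ i, Fin rows → Fin n → K i
  /-- the program executed for every symbol -/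
  prog : List (UpdateInstr K reg idx)

namespace UpdateMachine

variable {n : ℕ} (M : UpdateMachine n)

instance (i : Fin M.f) : Field (M.K i) := M.field i

/-- The complete memory content of the machine. -/
structure Mem where
  /-- the field registers -/
  val : ∀ i, Fin (M.reg i) → M.K i
  /-- the index registers; they are not changed while the stream is read -/
  index : Fin M.idx → Fin M.rows
  /-- the number of symbols that have been processed -/
  pos : Fin (n + 1)

/-- Store `v` in the register `dst` of the field `K i`. -/
def Mem.set {M : UpdateMachine n} (μ : M.Mem) (i : Fin M.f) (dst : Fin (M.reg i)) (v : M.K i) :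
    M.Mem :=
  { μ with val := Function.update μ.val i (Function.update (μ.val i) dst v) }

/-- The effect of one instruction, where `a` is the current symbol. -/
def exec {m : ℕ} (a : Fin m) (μ : M.Mem) : UpdateInstr M.K M.reg M.idx → M.Mem
  | .const i dst c => μ.set i dst c
  | .add i dst x y => μ.set i dst (μ.val i x + μ.val i y)
  | .mul i dst x y => μ.set i dst (μ.val i x * μ.val i y)
  | .digit i dst j => μ.set i dst (if a.val.testBit j then 1 else 0)
  | .entry i dst x =>
    μ.set i dst (if h : μ.pos.val < n then M.G i (μ.index x) ⟨μ.pos.val, h⟩ else 0)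

/-- Advance the position counter (which stops at `n`). -/
def Mem.advance {M : UpdateMachine n} (μ : M.Mem) : M.Mem :=
  { μ with pos := ⟨min (μ.pos.val + 1) n, by omega⟩ }

/-- Processing of one symbol: run the program, then advance the position counter. -/
def update {m : ℕ} (μ : M.Mem) (a : Fin m) : M.Mem :=
  (M.prog.foldl (M.exec a) μ).advance

/-- Number of unit-cost steps per symbol: the instructions of the program, and the increment of the
position counter. -/
def time : ℕ := M.prog.length + 1

end UpdateMachine

/-- The verifier `V` processes every symbol of a stream of length `n` in at most `T` unit-cost
steps, working in finite fields with at most `w` elements.  While the stream is read, the memory of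
`V` holds the memory of the machine (including all registers for intermediate results). -/
def SIPVerifier.UpdateTimeLE {m d : ℕ} (V : SIPVerifier m d) (n w T : ℕ) : Prop :=
  ∃ M : UpdateMachine n, (∀ i, Nat.card (M.K i) ≤ w) ∧ M.time ≤ T ∧
    ∃ enc : M.Mem → V.State, Function.Injective enc ∧
      (∀ s ∈ V.init.support, ∃ μ : M.Mem, μ.pos = 0 ∧ enc μ = s) ∧
      ∀ (μ : M.Mem) (a : Fin m), V.update (enc μ) a = enc (M.update μ a)

/-!
The protocol runs the sum-check protocol in several small fields at once.

For a prime `p`, fix a matrix `G` over `𝔽_p` with `n` columns such that every nonempty set of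
columns has a nonzero sum in at least half of the rows; a random matrix with `n` rows has this
property (`exists_matrix_sum_ne_zero`). For a row `α`, let `y_α(x)` be the sum of the entries
`G α k` with `σ k = x`. As a vector indexed by the elements `x` of the universe, this is a linear
sketch of the stream `σ`: it vanishes at the `x` that do not occur, and does not vanish at a given
`x` that occurs for at least half of the rows. Hence, with `t = O(log m)` random rows, all elements that occur are detected with high
probability (`Sketch.card_not_good_mul_le`), and then `1 - ∏ τ, (1 - y_{α τ}(x) ^ (p - 1))` is the
indicator function of the elements that occur.

Identify the universe with a part of the cube `{0, -1} ^ L`, `L = ⌈log₂ m⌉`. The multilinear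
extension of `y_α` is, up to signs on the cube, `z ↦ ∑ k, G α k * ∏ j, (a_{k,j} + z j)`, where
`a_{k,j}` are the binary digits of the `k`-th symbol; with `{0, -1}` in place of `{0, 1}` each
factor takes a single addition. Its value at a random point `z` over an extension field `K` of
`𝔽_p` can be computed while the stream is read (`UpdateMachine.foldl_update_spec`). The indicator
function thus extends to a polynomial of degree at most `t (p - 1)` in each variable, whose sum
over the cube is `F₀` modulo `p` (`Sketch.partialSum_occurs`), and whose value at `z` is known to
the verifier. The sum-check protocol with `L` rounds verifies the sum
(`SumCheck.card_accepts_mul_card_le`). It is carried out for `L` different primes `p` of size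
`O(log m log log m)`, in the product of the fields, and the sum is recovered from its residues by
the Chinese remainder theorem (`SketchSetup.result_eq_some`). Enough primes of this size exist by
Chebyshev's bound (`lt_primeCounting`).

The prover may adapt his messages in one field to the random points in the others; therefore the
soundness of the sum-check protocol is stated for points that are projections of common
randomness. The verifier evaluates the prover's polynomials by Horner's rule as the bits arrive,
so that it only stores a constant number of elements of the product of the fields in addition to
the random point and the sketches (`SumCheckData.answer_start`).
-/

/-! ### Functions of low degree in every coordinate -/

open Polynomial in
/-- In each single coordinate, with the others fixed, `F` is a polynomial of degree at most `D`. -/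
def CoordDegreeLE {ι K : Type*} [DecidableEq ι] [Field K] (D : ℕ) (F : (ι → K) → K) : Prop :=
  ∀ (z : ι → K) (j : ι), ∃ q : K[X], q.natDegree ≤ D ∧ ∀ x, q.eval x = F (Function.update z j x)

namespace CoordDegreeLE

open Polynomial

variable {ι K : Type*} [DecidableEq ι] [Field K] {D E : ℕ} {F G : (ι → K) → K}

lemma const (c : K) : CoordDegreeLE (ι := ι) D fun _ => c :=
  fun _ _ => ⟨C c, by simp, by simp⟩

lemma mono (hF : CoordDegreeLE D F) (h : D ≤ E) : CoordDegreeLE E F := fun z j =>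
  let ⟨q, hq, hq'⟩ := hF z j
  ⟨q, hq.trans h, hq'⟩

lemma add (hF : CoordDegreeLE D F) (hG : CoordDegreeLE D G) :
    CoordDegreeLE D fun z => F z + G z := fun z j => by
  obtain ⟨q, hq, hq'⟩ := hF z j
  obtain ⟨r, hr, hr'⟩ := hG z j
  exact ⟨q + r, natDegree_add_le_of_degree_le hq hr, fun x => by simp [hq', hr']⟩

lemma one_sub (hF : CoordDegreeLE D F) : CoordDegreeLE D fun z => 1 - F z := fun z j => by
  obtain ⟨q, hq, hq'⟩ := hF z j
  exact ⟨1 - q, (natDegree_sub_le _ _).trans (by simpa using hq), fun x => by simp [hq']⟩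

lemma mul (hF : CoordDegreeLE D F) (hG : CoordDegreeLE E G) :
    CoordDegreeLE (D + E) fun z => F z * G z := fun z j => by
  obtain ⟨q, hq, hq'⟩ := hF z j
  obtain ⟨r, hr, hr'⟩ := hG z j
  exact ⟨q * r, natDegree_mul_le_of_le hq hr, fun x => by simp [hq', hr']⟩

lemma pow (hF : CoordDegreeLE D F) (k : ℕ) : CoordDegreeLE (k * D) fun z => F z ^ k :=
  fun z j => by
  obtain ⟨q, hq, hq'⟩ := hF z j
  exact ⟨q ^ k, natDegree_pow_le_of_le k hq, fun x => by simp [hq']⟩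

lemma sum {κ : Type*} (s : Finset κ) {F : κ → (ι → K) → K}
    (hF : ∀ k ∈ s, CoordDegreeLE D (F k)) : CoordDegreeLE D fun z => ∑ k ∈ s, F k z := by
  classical
  induction s using Finset.induction_on with
  | empty => simpa using const 0
  | insert a s ha ih =>
    simp only [Finset.sum_insert ha]
    exact (hF a (Finset.mem_insert_self _ _)).add
      (ih fun k hk => hF k (Finset.mem_insert_of_mem hk))

lemma prod {κ : Type*} (s : Finset κ) {F : κ → (ι → K) → K}
    (hF : ∀ k ∈ s, CoordDegreeLE D (F k)) :
    CoordDegreeLE (s.card * D) fun z => ∏ k ∈ s, F k z := by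
  classical
  induction s using Finset.induction_on with
  | empty => simpa using const 1
  | insert a s ha ih =>
    simp only [Finset.prod_insert ha, Finset.card_insert_of_notMem ha]
    refine ((hF a (Finset.mem_insert_self _ _)).mul
      (ih fun k hk => hF k (Finset.mem_insert_of_mem hk))).mono ?_
    rw [Nat.succ_mul, add_comm]

lemma prod_const_add [Fintype ι] (a : ι → K) : CoordDegreeLE 1 fun z => ∏ j, (a j + z j) :=
  fun z j => by
  refine ⟨C (∏ k ∈ Finset.univ.erase j, (a k + z k)) * (X + C (a j)), ?_, fun x => ?_⟩
  · exact natDegree_C_mul_le _ _ |>.trans (natDegree_add_le_of_degree_le natDegree_X_le (by simp))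
  · beta_reduce
    rw [← Finset.mul_prod_erase _ _ (Finset.mem_univ j), eval_mul, eval_C, mul_comm]
    congr 1
    · simp [add_comm]
    · refine Finset.prod_congr rfl fun k hk => ?_
      rw [Function.update_of_ne (Finset.ne_of_mem_erase hk)]

end CoordDegreeLE

/-! ### Roots in a random coordinate -/

section Counting

open Polynomial

/-- Schwartz–Zippel for one coordinate: if a polynomial depends only on the coordinates of `ω`
other than `j`, then it is rarely the case that it is nonzero but vanishes at (the image
in `K` of) the coordinate `j`. -/
lemma card_eval_eq_zero_mul_card_le {ι Ω K : Type*} [Fintype ι] [DecidableEq ι] [Fintype Ω]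
    [Field K] [Fintype K] (π : Ω → K)
    (hπ : ∀ a, Nat.card {x // π x = a} * Fintype.card K ≤ Fintype.card Ω)
    (j : ι) (D : ℕ) (q : (ι → Ω) → K[X]) (hD : ∀ ω, (q ω).natDegree ≤ D)
    (hq : ∀ ω x, q (Function.update ω j x) = q ω) :
    Nat.card {ω // q ω ≠ 0 ∧ (q ω).eval (π (ω j)) = 0} * Fintype.card K ≤
      D * Fintype.card (ι → Ω) := by
  classical
  rcases isEmpty_or_nonempty Ω with hΩ | hΩ
  · have : IsEmpty (ι → Ω) := ⟨fun ω => hΩ.elim (ω j)⟩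
    simp
  set Bad : Finset (ι → Ω) :=
    Finset.univ.filter fun ω => q ω ≠ 0 ∧ (q ω).eval (π (ω j)) = 0 with hBad
  have hcard : Nat.card {ω // q ω ≠ 0 ∧ (q ω).eval (π (ω j)) = 0} = Bad.card := by
    rw [Nat.card_eq_fintype_card, Fintype.card_subtype]
  rw [hcard]
  -- count the pairs `(ω, x)` for which `ω` is bad once its coordinate `j` is replaced by `x`
  have h1 : Bad.card * Fintype.card Ω = ∑ ω : ι → Ω,
      (Finset.univ.filter fun x : Ω => Function.update ω j x ∈ Bad).card := by
    rw [← Finset.card_univ, ← Finset.card_product, ← Finset.card_sigma]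
    refine Finset.card_bij' (fun a _ => ⟨Function.update a.1 j a.2, a.1 j⟩)
      (fun a _ => (Function.update a.1 j a.2, a.1 j)) ?_ ?_ ?_ ?_
    · simp +contextual
    · simp
    · simp
    · simp
  have h2 : ∀ ω : ι → Ω, (Finset.univ.filter fun x : Ω => Function.update ω j x ∈ Bad).card *
      Fintype.card K ≤ D * Fintype.card Ω := by
    intro ω
    by_cases h0 : q ω = 0
    · simp [hBad, hq, h0]
    have hsub : (Finset.univ.filter fun x : Ω => Function.update ω j x ∈ Bad) ⊆
        (q ω).roots.toFinset.biUnion fun a => Finset.univ.filter fun x => π x = a := by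
      intro x
      simp [hBad, hq, h0]
    calc _ ≤ (∑ a ∈ (q ω).roots.toFinset, (Finset.univ.filter fun x => π x = a).card) *
          Fintype.card K :=
          Nat.mul_le_mul_right _ ((Finset.card_le_card hsub).trans Finset.card_biUnion_le)
      _ = ∑ a ∈ (q ω).roots.toFinset, (Finset.univ.filter fun x => π x = a).card *
          Fintype.card K := Finset.sum_mul _ _ _
      _ ≤ ∑ a ∈ (q ω).roots.toFinset, Fintype.card Ω := by
          refine Finset.sum_le_sum fun a _ => ?_
          have := hπ a
          rwa [Nat.card_eq_fintype_card, Fintype.card_subtype] at this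
      _ ≤ D * Fintype.card Ω := by
          rw [Finset.sum_const, smul_eq_mul]
          exact Nat.mul_le_mul_right _
            ((Multiset.toFinset_card_le _).trans ((card_roots' _).trans (hD ω)))
  have h3 := Finset.sum_le_sum fun ω (_ : ω ∈ Finset.univ) => h2 ω
  rw [← Finset.sum_mul, ← h1, Finset.sum_const, smul_eq_mul, Finset.card_univ] at h3
  refine Nat.le_of_mul_le_mul_right ?_ (Fintype.card_pos (α := Ω))
  calc _ = _ := by ring
    _ ≤ _ := h3
    _ = _ := by ring

end Counting

/-! ### The sum-check protocol over the cube `{0, -1}ᵈ` -/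

namespace SumCheck

open Polynomial

variable {K : Type*} [Field K] {d : ℕ}

open Classical in
/-- The points whose first `j` coordinates are those of `r`, the others being in `{0, -1}`. -/
noncomputable def subcube (j : ℕ) (r : Fin d → K) : Finset (Fin d → K) :=
  Fintype.piFinset fun k : Fin d => if k.val < j then {r k} else {0, -1}

/-- The sum of `H` over the points of the cube whose first `j` coordinates have been replaced
by those of `r`. -/
noncomputable def partialSum (H : (Fin d → K) → K) (j : ℕ) (r : Fin d → K) : K :=
  ∑ z ∈ subcube j r, H z

lemma mem_subcube {j : ℕ} {r z : Fin d → K} :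
    z ∈ subcube j r ↔ ∀ k : Fin d, (k.val < j → z k = r k) ∧ (j ≤ k.val → z k = 0 ∨ z k = -1) := by
  classical
  simp only [subcube, Fintype.mem_piFinset]
  refine forall_congr' fun k => ?_
  by_cases h : k.val < j
  · simp [h, h.not_ge]
  · simp [h, not_lt.mp h]

lemma partialSum_congr {H : (Fin d → K) → K} {j : ℕ} {r r' : Fin d → K}
    (h : ∀ k : Fin d, k.val < j → r k = r' k) : partialSum H j r = partialSum H j r' := by
  unfold partialSum
  congr 1
  ext z
  simp only [mem_subcube]
  refine forall_congr' fun k => and_congr_left fun _ => imp_congr_right fun hk => ?_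
  rw [h k hk]

lemma partialSum_last (H : (Fin d → K) → K) (r : Fin d → K) : partialSum H d r = H r := by
  have : subcube d r = {r} := by
    ext z
    simp only [mem_subcube, Finset.mem_singleton, funext_iff]
    exact forall_congr' fun k => by simp [k.isLt.not_ge]
  rw [partialSum, this, Finset.sum_singleton]

/-- Splitting the sum according to the coordinate `j` gives the identity that is checked in round
`j`. -/
lemma partialSum_eq_add (H : (Fin d → K) → K) (j : Fin d) (r : Fin d → K) :
    partialSum H j r = partialSum H (j + 1) (Function.update r j 0) +
      partialSum H (j + 1) (Function.update r j (-1)) := by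
  classical
  have key : ∀ x : K, (x = 0 ∨ x = -1) → subcube (j + 1) (Function.update r j x) =
      (subcube j r).filter fun z => z j = x := by
    intro x hx
    ext z
    simp only [mem_subcube, Finset.mem_filter]
    constructor
    · intro h
      have hj : z j = x := by simpa using (h j).1 (Nat.lt_succ_self _)
      refine ⟨fun k => ⟨fun hk => ?_, fun hk => ?_⟩, hj⟩
      · have := (h k).1 (by omega)
        rwa [Function.update_of_ne (Fin.ne_of_lt hk)] at this
      · rcases hk.eq_or_lt with hk | hk
        · rw [← Fin.ext hk, hj]; exact hx
        · exact (h k).2 hk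
    · rintro ⟨h, hj⟩ k
      refine ⟨fun hk => ?_, fun hk => (h k).2 (by omega)⟩
      by_cases hkj : k = j
      · subst hkj; simpa using hj
      · rw [Function.update_of_ne hkj]
        exact (h k).1 (lt_of_le_of_ne (Nat.lt_succ_iff.mp hk) fun e => hkj (Fin.ext e))
  rw [partialSum, partialSum, partialSum, key 0 (Or.inl rfl), key (-1) (Or.inr rfl),
    ← Finset.sum_union]
  · refine Finset.sum_congr ?_ fun _ _ => rfl
    ext z
    simp only [Finset.mem_union, Finset.mem_filter, ← and_or_left, iff_self_and]
    exact fun h => (mem_subcube.mp h j).2 le_rfl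
  · refine Finset.disjoint_filter.mpr fun z _ h0 h1 => ?_
    rw [h0] at h1
    exact one_ne_zero (neg_eq_zero.mp h1.symm)

lemma coordDegreeLE_partialSum {H : (Fin d → K) → K} {D : ℕ} (hH : CoordDegreeLE D H) {j : ℕ}
    (hj : j ≤ d) : CoordDegreeLE D (partialSum H j) := by
  induction hj using Nat.decreasingInduction with
  | self => simpa only [funext (partialSum_last H)] using hH
  | of_succ k hk ih =>
    have hfix : ∀ c : K, CoordDegreeLE D fun r : Fin d → K =>
        partialSum H (k + 1) (Function.update r ⟨k, hk⟩ c) := by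
      intro c z j
      by_cases hj : j = ⟨k, hk⟩
      · refine ⟨C (partialSum H (k + 1) (Function.update z ⟨k, hk⟩ c)), by simp, fun x => ?_⟩
        simp [hj]
      · obtain ⟨q, hq, hq'⟩ := ih (Function.update z ⟨k, hk⟩ c) j
        refine ⟨q, hq, fun x => ?_⟩
        beta_reduce
        rw [hq' x, Function.update_comm hj]
    have : partialSum H k = fun r => partialSum H (k + 1) (Function.update r ⟨k, hk⟩ 0) +
        partialSum H (k + 1) (Function.update r ⟨k, hk⟩ (-1)) :=
      funext fun r => partialSum_eq_add H ⟨k, hk⟩ r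
    rw [this]
    exact (hfix 0).add (hfix (-1))

open Classical in
/-- A polynomial of degree at most `D` that induces the function `φ` (zero if there is none). -/
noncomputable def polyOfFun (D : ℕ) (φ : K → K) : K[X] :=
  if h : ∃ q : K[X], q.natDegree ≤ D ∧ ∀ x, q.eval x = φ x then h.choose else 0

/-- The message of the honest prover in round `j`: the sum over the cube, as a polynomial in the
coordinate `j`, when the earlier coordinates are those of `r`. -/
noncomputable def honestPoly (H : (Fin d → K) → K) (D : ℕ) (j : Fin d) (r : Fin d → K) : K[X] :=
  polyOfFun D fun x => partialSum H (j + 1) (Function.update r j x)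

lemma natDegree_honestPoly_le (H : (Fin d → K) → K) (D : ℕ) (j : Fin d) (r : Fin d → K) :
    (honestPoly H D j r).natDegree ≤ D := by
  unfold honestPoly polyOfFun
  split_ifs with h
  · exact h.choose_spec.1
  · simp

lemma eval_honestPoly {H : (Fin d → K) → K} {D : ℕ} (hH : CoordDegreeLE D H) (j : Fin d)
    (r : Fin d → K) (x : K) :
    (honestPoly H D j r).eval x = partialSum H (j + 1) (Function.update r j x) := by
  have h := coordDegreeLE_partialSum hH (Nat.succ_le_of_lt j.isLt) r j
  unfold honestPoly polyOfFun
  rw [dif_pos h]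
  exact h.choose_spec.2 x

lemma honestPoly_congr {H : (Fin d → K) → K} {D : ℕ} {j : Fin d} {r r' : Fin d → K}
    (h : ∀ k < j, r k = r' k) : honestPoly H D j r = honestPoly H D j r' := by
  refine congrArg (polyOfFun D) (funext fun x => partialSum_congr fun k hk => ?_)
  by_cases hkj : k = j
  · subst hkj; simp
  · rw [Function.update_of_ne hkj, Function.update_of_ne hkj]
    exact h k (lt_of_le_of_ne (Nat.lt_succ_iff.mp hk) hkj)

lemma eval_honestPoly_self {H : (Fin d → K) → K} {D : ℕ} (hH : CoordDegreeLE D H) (j : Fin d)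
    (r : Fin d → K) : (honestPoly H D j r).eval (r j) = partialSum H (j + 1) r := by
  rw [eval_honestPoly hH, Function.update_eq_self]

lemma eval_honestPoly_zero_add {H : (Fin d → K) → K} {D : ℕ} (hH : CoordDegreeLE D H) (j : Fin d)
    (r : Fin d → K) :
    (honestPoly H D j r).eval 0 + (honestPoly H D j r).eval (-1) = partialSum H j r := by
  rw [eval_honestPoly hH, eval_honestPoly hH, partialSum_eq_add]

/-- The checks of the verifier at the point `r`, when the prover sends the polynomials `g`. -/
def Accepts (H : (Fin d → K) → K) (g : Fin d → K[X]) (r : Fin d → K) : Prop :=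
  (∀ k k' : Fin d, k'.val = k.val + 1 → (g k').eval 0 + (g k').eval (-1) = (g k).eval (r k)) ∧
  ∀ k : Fin d, k.val + 1 = d → (g k).eval (r k) = H r

lemma accepts_honestPoly {H : (Fin d → K) → K} {D : ℕ} (hH : CoordDegreeLE D H)
    (r : Fin d → K) : Accepts H (fun j => honestPoly H D j r) r := by
  refine ⟨fun k k' hk => ?_, fun k hk => ?_⟩
  · rw [eval_honestPoly_zero_add hH, eval_honestPoly_self hH, hk]
  · rw [eval_honestPoly_self hH, hk, partialSum_last]

/-- If the verifier is convinced of a wrong sum, then some message of the prover differs from the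
honest one, but agrees with it at the random point. -/
lemma exists_eval_eq_of_accepts {H : (Fin d → K) → K} {D : ℕ} (hH : CoordDegreeLE D H)
    {g : Fin d → K[X]} {r : Fin d → K} (hacc : Accepts H g r) (j₀ : Fin d) (hj₀ : j₀.val = 0)
    (hne : (g j₀).eval 0 + (g j₀).eval (-1) ≠ partialSum H 0 r) :
    ∃ j : Fin d, g j - honestPoly H D j r ≠ 0 ∧
      (g j - honestPoly H D j r).eval (r j) = 0 := by
  by_contra! hcon
  -- as long as the claims are wrong, the messages are wrong, and so are their values at `r`
  have step : ∀ j : Fin d, (g j).eval 0 + (g j).eval (-1) ≠ partialSum H j r →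
      (g j).eval (r j) ≠ partialSum H (j + 1) r := by
    intro j hj he
    refine hcon j (fun h0 => hj ?_) ?_
    · rw [sub_eq_zero.mp h0, eval_honestPoly_zero_add hH]
    · rw [eval_sub, he, eval_honestPoly_self hH, sub_self]
  have all : ∀ (k : ℕ) (hk : k < d), (g ⟨k, hk⟩).eval (r ⟨k, hk⟩) ≠ partialSum H (k + 1) r := by
    intro k
    induction k with
    | zero =>
      intro hk
      refine step ⟨0, hk⟩ ?_
      rwa [show (⟨0, hk⟩ : Fin d) = j₀ from Fin.ext hj₀.symm, hj₀]
    | succ k ih =>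
      intro hk
      refine step ⟨k + 1, hk⟩ ?_
      rw [hacc.1 ⟨k, by omega⟩ ⟨k + 1, hk⟩ rfl]
      exact ih (by omega)
  have hd : 0 < d := j₀.pos
  refine all (d - 1) (by omega) ?_
  rw [hacc.2 ⟨d - 1, by omega⟩ (by simp; omega), show d - 1 + 1 = d by omega, partialSum_last]

/-- Soundness of the sum-check protocol.  The random points are images of elements of `Ω`, so that
several instances over different fields can be run at the same time, with messages that depend on
all of the randomness revealed so far. -/
theorem card_accepts_mul_card_le {Ω : Type*} [Fintype Ω] [Fintype K] (π : Ω → K)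
    (hπ : ∀ a, Nat.card {x // π x = a} * Fintype.card K ≤ Fintype.card Ω)
    {H : (Fin d → K) → K} {D : ℕ} (hH : CoordDegreeLE D H) (j₀ : Fin d) (hj₀ : j₀.val = 0)
    (S : K) (hS : ∀ r, partialSum H 0 r = S)
    (g : (Fin d → Ω) → Fin d → K[X]) (hdeg : ∀ ω j, (g ω j).natDegree ≤ D)
    (hg : ∀ ω ω' j, (∀ k < j, ω k = ω' k) → g ω j = g ω' j) :
    Nat.card {ω // Accepts H (g ω) (fun j => π (ω j)) ∧
      (g ω j₀).eval 0 + (g ω j₀).eval (-1) ≠ S} * Fintype.card K ≤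
      d * D * Fintype.card (Fin d → Ω) := by
  classical
  set q : Fin d → (Fin d → Ω) → K[X] :=
    fun j ω => g ω j - honestPoly H D j (fun k => π (ω k)) with hq
  have hsub : (Finset.univ.filter fun ω => Accepts H (g ω) (fun j => π (ω j)) ∧
      (g ω j₀).eval 0 + (g ω j₀).eval (-1) ≠ S) ⊆
      (Finset.univ : Finset (Fin d)).biUnion fun j =>
        Finset.univ.filter fun ω => q j ω ≠ 0 ∧ (q j ω).eval (π (ω j)) = 0 := by
    intro ω hω
    obtain ⟨hacc, hne⟩ := (Finset.mem_filter.mp hω).2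
    rw [← hS fun j => π (ω j)] at hne
    obtain ⟨j, h1, h2⟩ := exists_eval_eq_of_accepts hH hacc j₀ hj₀ hne
    exact Finset.mem_biUnion.mpr ⟨j, Finset.mem_univ _, Finset.mem_filter.mpr ⟨Finset.mem_univ _,
      h1, h2⟩⟩
  have hcount : ∀ j, (Finset.univ.filter fun ω => q j ω ≠ 0 ∧ (q j ω).eval (π (ω j)) = 0).card *
      Fintype.card K ≤ D * Fintype.card (Fin d → Ω) := by
    intro j
    have := card_eval_eq_zero_mul_card_le π hπ j D (q j)
      (fun ω => (natDegree_sub_le _ _).trans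
        (max_le (hdeg ω j) (natDegree_honestPoly_le _ _ _ _)))
      (fun ω x => by
        have hne : ∀ k < j, Function.update ω j x k = ω k :=
          fun k hk => Function.update_of_ne hk.ne _ _
        simp only [hq]
        rw [hg _ ω j hne, honestPoly_congr (r' := fun k => π (ω k))]
        intro k hk
        rw [hne k hk])
    rwa [Nat.card_eq_fintype_card, Fintype.card_subtype] at this
  rw [Nat.card_eq_fintype_card, Fintype.card_subtype]
  calc _ ≤ (∑ j, (Finset.univ.filter fun ω => q j ω ≠ 0 ∧ (q j ω).eval (π (ω j)) = 0).card) *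
        Fintype.card K :=
        Nat.mul_le_mul_right _ ((Finset.card_le_card hsub).trans Finset.card_biUnion_le)
    _ = ∑ j, (Finset.univ.filter fun ω => q j ω ≠ 0 ∧ (q j ω).eval (π (ω j)) = 0).card *
        Fintype.card K := Finset.sum_mul _ _ _
    _ ≤ ∑ _j : Fin d, D * Fintype.card (Fin d → Ω) := Finset.sum_le_sum fun j _ => hcount j
    _ = _ := by simp [mul_assoc]

end SumCheck

/-! ### A linear code of large distance -/

section Code

open Polynomial

lemma card_sum_eq_zero_mul_le {p : ℕ} [Fact p.Prime] {ι : Type*} [Fintype ι]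
    {s : Finset ι} (hs : s.Nonempty) :
    Nat.card {g : ι → ZMod p // ∑ k ∈ s, g k = 0} * p ≤ p ^ Fintype.card ι := by
  classical
  obtain ⟨j, hj⟩ := hs
  have h := card_eval_eq_zero_mul_card_le (Ω := ZMod p) (K := ZMod p) (ι := ι) id
    (fun a => by simp) j 1
    (fun g => X + C (∑ k ∈ s.erase j, g k))
    (fun g => (natDegree_add_C).trans_le natDegree_X_le)
    (fun g x => by
      have : ∑ k ∈ s.erase j, Function.update g j x k = ∑ k ∈ s.erase j, g k :=
        Finset.sum_congr rfl fun k hk => Function.update_of_ne (Finset.ne_of_mem_erase hk) _ _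
      rw [this])
  have hiff : ∀ g : ι → ZMod p, (X + C (∑ k ∈ s.erase j, g k) ≠ 0 ∧
      (X + C (∑ k ∈ s.erase j, g k)).eval (id (g j)) = 0) ↔ ∑ k ∈ s, g k = 0 := by
    intro g
    rw [← Finset.add_sum_erase s g hj]
    simp only [ne_eq, X_add_C_ne_zero, not_false_eq_true, true_and, eval_add, eval_X, eval_C,
      id_eq]
  simp only [hiff] at h
  simpa [ZMod.card] using h

/-- The matrices agreed upon before the stream starts: every nonempty set `s` of columns has a
nonzero sum in at least half of the rows.  Such a matrix exists since a random one violates the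
condition for given `s` in a given set of more than `n / 2` rows with probability less than
`p ^ (-n / 2) ≤ 4 ^ (-n)`, whereas there are fewer than `4 ^ n` choices of the two sets. -/
theorem exists_matrix_sum_ne_zero (p : ℕ) [Fact p.Prime] (hp : 16 ≤ p) (n : ℕ) :
    ∃ G : Fin n → Fin n → ZMod p, ∀ s : Finset (Fin n), s.Nonempty →
      2 * Nat.card {α // ∑ k ∈ s, G α k = 0} ≤ n := by
  classical
  by_contra! hcon
  let Z : Finset (Fin n) → Finset (Fin n → ZMod p) :=
    fun s => Finset.univ.filter fun g => ∑ k ∈ s, g k = 0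
  let I : Finset (Finset (Fin n) × Finset (Fin n)) :=
    Finset.univ.filter fun c => c.1.Nonempty ∧ n < 2 * c.2.card
  let Y : Finset (Fin n) × Finset (Fin n) → Finset (Fin n → Fin n → ZMod p) := fun c =>
    Fintype.piFinset fun α => if α ∈ c.2 then Z c.1 else Finset.univ
  have hcover : (Finset.univ : Finset (Fin n → Fin n → ZMod p)) ⊆ I.biUnion Y := by
    intro G _
    obtain ⟨s, hs, hn⟩ := hcon G
    refine Finset.mem_biUnion.mpr ⟨(s, Finset.univ.filter fun α => ∑ k ∈ s, G α k = 0), ?_, ?_⟩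
    · rw [Nat.card_eq_fintype_card, Fintype.card_subtype] at hn
      simpa [I, hs] using hn
    · simp only [Y, Z, Fintype.mem_piFinset, Finset.mem_filter, Finset.mem_univ, true_and]
      intro α
      split_ifs with h
      · simpa using h
      · simp
  have hY : ∀ c ∈ I, (Y c).card * 4 ^ (n + 1) ≤ (p ^ n) ^ n := by
    rintro ⟨s, S⟩ hc
    obtain ⟨hs, hS⟩ : s.Nonempty ∧ n < 2 * S.card := by simpa [I] using hc
    have hZ : (Z s).card * p ≤ p ^ n := by
      have := card_sum_eq_zero_mul_le (p := p) hs
      rwa [Nat.card_eq_fintype_card, Fintype.card_subtype, Fintype.card_fin] at this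
    have hcard : (Y (s, S)).card = (Z s).card ^ S.card * (p ^ n) ^ (n - S.card) := by
      simp only [Y, Fintype.card_piFinset]
      have : ∀ α, (if α ∈ S then Z s else Finset.univ).card =
          if α ∈ S then (Z s).card else p ^ n := by
        intro α
        split_ifs <;> simp [ZMod.card]
      simp only [this, Finset.prod_ite, Finset.prod_const]
      congr 2
      · congr 1; ext; simp
      · have h := Finset.card_compl S
        rw [Fintype.card_fin] at h
        rw [← h]
        congr 1; ext; simp
    have hp4 : 4 ^ (n + 1) ≤ p ^ S.card := by
      calc 4 ^ (n + 1) ≤ 4 ^ (2 * S.card) := Nat.pow_le_pow_right (by norm_num) hS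
        _ = 16 ^ S.card := by rw [pow_mul]; norm_num
        _ ≤ p ^ S.card := Nat.pow_le_pow_left hp _
    have hSn : S.card ≤ n := by simpa using Finset.card_le_univ S
    calc (Y (s, S)).card * 4 ^ (n + 1) ≤
        (Z s).card ^ S.card * (p ^ n) ^ (n - S.card) * p ^ S.card := by
          rw [hcard]; exact Nat.mul_le_mul_left _ hp4
      _ = ((Z s).card * p) ^ S.card * (p ^ n) ^ (n - S.card) := by rw [mul_pow]; ring
      _ ≤ (p ^ n) ^ S.card * (p ^ n) ^ (n - S.card) :=
          Nat.mul_le_mul_right _ (Nat.pow_le_pow_left hZ _)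
      _ = (p ^ n) ^ n := by rw [← pow_add, Nat.add_sub_cancel' hSn]
  have hI : I.card ≤ 4 ^ n := by
    refine (Finset.card_le_univ I).trans_eq ?_
    simp [← mul_pow]
  have hall : (p ^ n) ^ n ≤ ∑ c ∈ I, (Y c).card := by
    have := (Finset.card_le_card hcover).trans Finset.card_biUnion_le
    simpa [ZMod.card] using this
  have hlt : (p ^ n) ^ n * 4 ^ (n + 1) ≤ 4 ^ n * (p ^ n) ^ n :=
    calc (p ^ n) ^ n * 4 ^ (n + 1) ≤ (∑ c ∈ I, (Y c).card) * 4 ^ (n + 1) :=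
          Nat.mul_le_mul_right _ hall
      _ = ∑ c ∈ I, (Y c).card * 4 ^ (n + 1) := Finset.sum_mul _ _ _
      _ ≤ ∑ _c ∈ I, (p ^ n) ^ n := Finset.sum_le_sum hY
      _ = I.card * (p ^ n) ^ n := by simp
      _ ≤ _ := Nat.mul_le_mul_right _ hI
  have hpos : 0 < (p ^ n) ^ n := pow_pos (pow_pos (by omega) _) _
  have h4 : 0 < 4 ^ n := pow_pos (by norm_num) n
  rw [pow_succ] at hlt
  nlinarith [Nat.mul_pos hpos h4]

end Code

/-! ### Primes of almost linear size -/

section Primes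

/-- A weak form of Chebyshev's lower bound for the number of primes. -/
lemma lt_primeCounting {k u : ℕ} (hk : k ≤ 2 ^ u) (hu : 2 ≤ u) :
    k ≤ Nat.primeCounting (4 * (k + 1) * u) := by
  by_contra! hlt
  set N := 4 * (k + 1) * u with hN
  have h1 : Nat.lcmUpto N ≤ N ^ k := by
    rw [Nat.lcmUpto_eq_prod_pow_log]
    have hcard : (Nat.primesLE N).card = Nat.primeCounting N := by
      simp
    have hN0 : N ≠ 0 := by positivity
    calc _ ≤ ∏ p ∈ Nat.primesLE N, N :=
          Finset.prod_le_prod' fun p _ => Nat.pow_log_le_self p hN0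
      _ = N ^ Nat.primeCounting N := by rw [Finset.prod_const, hcard]
      _ ≤ N ^ k := Nat.pow_le_pow_right (Nat.pos_of_ne_zero hN0) hlt.le
  have h2 := Chebyshev.two_pow_le_mul_lcmUpto N
  have h3 : N + 1 ≤ 2 ^ (2 * u + 3) := by
    have hu2 : u + 1 ≤ 2 ^ u := Nat.lt_two_pow_self
    have : (k + 1) * u + 1 ≤ 2 * (2 ^ u * 2 ^ u) := by nlinarith [Nat.one_le_two_pow (n := u)]
    calc N + 1 ≤ 4 * ((k + 1) * u + 1) := by rw [hN]; nlinarith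
      _ ≤ 4 * (2 * (2 ^ u * 2 ^ u)) := Nat.mul_le_mul_left _ this
      _ = 2 ^ (2 * u + 3) := by ring
  have h4 : 2 ^ N ≤ 2 ^ ((2 * u + 3) * (k + 1)) :=
    calc 2 ^ N ≤ (N + 1) * N ^ k := h2.trans (Nat.mul_le_mul_left _ h1)
      _ ≤ (N + 1) * (N + 1) ^ k := Nat.mul_le_mul_left _ (Nat.pow_le_pow_left (by omega) _)
      _ = (N + 1) ^ (k + 1) := by ring
      _ ≤ (2 ^ (2 * u + 3)) ^ (k + 1) := Nat.pow_le_pow_left h3 _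
      _ = _ := by rw [← pow_mul]
  have h5 := (Nat.pow_le_pow_iff_right (by norm_num)).mp h4
  rw [hN] at h5
  nlinarith

lemma nth_prime_le {k u i : ℕ} (hk : k ≤ 2 ^ u) (hu : 2 ≤ u) (hi : i < k) :
    Nat.nth Nat.Prime i ≤ 4 * (k + 1) * u := by
  have h := hi.trans_le (lt_primeCounting hk hu)
  rw [Nat.primeCounting, Nat.primeCounting'] at h
  exact Nat.lt_succ_iff.mp (Nat.nth_lt_of_lt_count h)

end Primes

/-! ### Evaluating the sketches while the stream is read -/

lemma List.foldl_finRange_induction {β : Type*} {n : ℕ} (g : β → Fin n → β) (I : ℕ → β → Prop)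
    (b : β) (h0 : I 0 b) (hs : ∀ (j : Fin n) b, I j b → I (j + 1) (g b j)) :
    I n ((List.finRange n).foldl g b) := by
  induction n with
  | zero => simpa using h0
  | succ n ih =>
    rw [List.finRange_succ_last, List.foldl_append, List.foldl_map]
    exact hs (Fin.last n) _ (ih (fun b j => g b j.castSucc) fun j b hb => hs j.castSucc b hb)

namespace UpdateMachine

variable {n : ℕ} {M : UpdateMachine n}

namespace Mem

lemma set_val_self (μ : M.Mem) (i : Fin M.f) (x : Fin (M.reg i)) (v : M.K i) :
    (μ.set i x v).val i x = v := by
  simp [Mem.set]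

lemma set_val_of_ne (μ : M.Mem) (i : Fin M.f) {x y : Fin (M.reg i)} (h : y ≠ x) (v : M.K i) :
    (μ.set i x v).val i y = μ.val i y := by
  simp [Mem.set, h]

lemma set_val_of_field_ne (μ : M.Mem) {i i' : Fin M.f} (h : i' ≠ i) (x : Fin (M.reg i))
    (v : M.K i) : (μ.set i x v).val i' = μ.val i' := by
  simp [Mem.set, h]

/-- `μ'` arises from `μ` by changing registers of the field `i` that are not in `S`. -/
structure Frame (i : Fin M.f) (S : Set (Fin (M.reg i))) (μ μ' : M.Mem) : Prop where
  index : μ'.index = μ.index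
  pos : μ'.pos = μ.pos
  other : ∀ i' ≠ i, μ'.val i' = μ.val i'
  keep : ∀ x ∈ S, μ'.val i x = μ.val i x

namespace Frame

variable {i : Fin M.f} {S : Set (Fin (M.reg i))} {μ μ' μ'' : M.Mem}

lemma refl (μ : M.Mem) : Frame i S μ μ := ⟨rfl, rfl, fun _ _ => rfl, fun _ _ => rfl⟩

lemma trans (h : Frame i S μ μ') (h' : Frame i S μ' μ'') : Frame i S μ μ'' :=
  ⟨h'.index.trans h.index, h'.pos.trans h.pos, fun i' hi => (h'.other i' hi).trans (h.other i' hi),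
    fun x hx => (h'.keep x hx).trans (h.keep x hx)⟩

lemma set {x : Fin (M.reg i)} (hx : x ∉ S) (v : M.K i) : Frame i S μ (μ.set i x v) :=
  ⟨rfl, rfl, fun _ h => set_val_of_field_ne μ h x v,
    fun _ hy => set_val_of_ne μ i (ne_of_mem_of_not_mem hy hx) v⟩

end Frame

end Mem

/-- The binary digit `j` of `a` as a field element. -/
def digitVal (F : Type*) [Field F] {m : ℕ} (a : Fin m) (j : ℕ) : F :=
  if a.val.testBit j then 1 else 0

/-- The entry of the matrix over `K i` in the given row, in the column of the current symbol. -/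
def Mem.currentEntry (μ : M.Mem) (i : Fin M.f) (α : Fin M.rows) : M.K i :=
  if h : μ.pos.val < n then M.G i α ⟨μ.pos.val, h⟩ else 0

section Program

variable {f L t : ℕ} {K : Fin f → Type} [∀ i, Field (K i)] {reg : Fin f → ℕ} (i : Fin f)
  (s : Fin L → Fin (reg i)) (y : Fin t → Fin (reg i)) (p w : Fin (reg i))

/-- Compute the product of all `a_j + s_j` in `p`, where `a_j` are the digits of the symbol. -/
def pointProg (idx : ℕ) : List (UpdateInstr K reg idx) :=
  .const i p 1 :: (List.finRange L).flatMap fun j =>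
    [.digit i w j.val, .add i w w (s j), .mul i p p w]

/-- Add the product of `p` and the current entry of row `τ` to the sketch `y τ`, for every `τ`. -/
def rowProg : List (UpdateInstr K reg t) :=
  (List.finRange t).flatMap fun τ => [.entry i w τ, .mul i w w p, .add i (y τ) (y τ) w]

end Program

section Exec

variable {m L : ℕ} {i : Fin M.f} {s : Fin L → Fin (M.reg i)} {p w : Fin (M.reg i)}

lemma exec_digits (hpw : p ≠ w) (hsp : ∀ j, s j ≠ p) (hsw : ∀ j, s j ≠ w) (a : Fin m)
    (l : List (Fin L)) (μ : M.Mem) :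
    let μ' := (l.flatMap fun j => ([.digit i w j.val, .add i w w (s j), .mul i p p w] :
      List (UpdateInstr M.K M.reg M.idx))).foldl (M.exec a) μ
    μ.Frame i {p, w}ᶜ μ' ∧
      μ'.val i p =
        μ.val i p * (l.map fun j : Fin L => digitVal (M.K i) a j + μ.val i (s j)).prod := by
  induction l generalizing μ with
  | nil => simp [Mem.Frame.refl]
  | cons j l ih =>
    set μ₁ := [UpdateInstr.digit i w j.val, .add i w w (s j), .mul i p p w].foldl (M.exec a) μ
      with hμ₁
    have hF : μ.Frame i {p, w}ᶜ μ₁ :=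
      ((Mem.Frame.set (by simp) _).trans (Mem.Frame.set (by simp) _)).trans
        (Mem.Frame.set (by simp) _)
    have hp : μ₁.val i p = μ.val i p * (digitVal (M.K i) a j + μ.val i (s j)) := by
      simp only [hμ₁, List.foldl_cons, List.foldl_nil, exec, Mem.set_val_self,
        Mem.set_val_of_ne _ _ hpw, Mem.set_val_of_ne _ _ (hsw j), digitVal]
    obtain ⟨h1, h2⟩ := ih μ₁
    simp only [List.flatMap_cons, List.foldl_append]
    refine ⟨hF.trans h1, ?_⟩
    rw [h2, hp, List.map_cons, List.prod_cons, mul_assoc]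
    congr 4
    funext j'
    rw [hF.keep _ (by simp [hsp, hsw])]

lemma exec_pointProg (hpw : p ≠ w) (hsp : ∀ j, s j ≠ p) (hsw : ∀ j, s j ≠ w) (a : Fin m)
    (μ : M.Mem) :
    let μ' := (pointProg i s p w M.idx).foldl (M.exec a) μ
    μ.Frame i {p, w}ᶜ μ' ∧ μ'.val i p = ∏ j : Fin L, (digitVal (M.K i) a j + μ.val i (s j)) := by
  have hF : μ.Frame i {p, w}ᶜ (M.exec a μ (.const i p 1)) := Mem.Frame.set (by simp) _
  obtain ⟨h1, h2⟩ := exec_digits hpw hsp hsw a (List.finRange L) (M.exec a μ (.const i p 1))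
  refine ⟨hF.trans h1, ?_⟩
  rw [pointProg, List.foldl_cons, h2, Fin.prod_univ_def]
  simp only [exec, Mem.set_val_self, one_mul, Mem.set_val_of_ne _ _ (hsp _)]

end Exec

section Rows

variable {m : ℕ} {i : Fin M.f} {p w : Fin (M.reg i)}

lemma exec_rows {y : Fin M.idx → Fin (M.reg i)} (hpw : p ≠ w) (hyp : ∀ τ, y τ ≠ p)
    (hyw : ∀ τ, y τ ≠ w) (hy : Function.Injective y) (a : Fin m) (l : List (Fin M.idx))
    (hl : l.Nodup) (μ : M.Mem) :
    let μ' := (l.flatMap fun τ => ([.entry i w τ, .mul i w w p, .add i (y τ) (y τ) w] :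
      List (UpdateInstr M.K M.reg M.idx))).foldl (M.exec a) μ
    μ.Frame i (insert w (Set.range y))ᶜ μ' ∧ ∀ τ, μ'.val i (y τ) =
      μ.val i (y τ) + if τ ∈ l then μ.currentEntry i (μ.index τ) * μ.val i p else 0 := by
  induction l generalizing μ with
  | nil => simp [Mem.Frame.refl]
  | cons τ l ih =>
    obtain ⟨hτ, hl⟩ := List.nodup_cons.mp hl
    set μ₁ := [UpdateInstr.entry i w τ, .mul i w w p, .add i (y τ) (y τ) w].foldl (M.exec a) μ
      with hμ₁
    have hF : μ.Frame i (insert w (Set.range y))ᶜ μ₁ :=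
      ((Mem.Frame.set (by simp) _).trans (Mem.Frame.set (by simp) _)).trans
        (Mem.Frame.set (by simp) _)
    have hself : μ₁.val i (y τ) =
        μ.val i (y τ) + μ.currentEntry i (μ.index τ) * μ.val i p := by
      simp only [hμ₁, List.foldl_cons, List.foldl_nil, exec, Mem.set_val_self,
        Mem.set_val_of_ne _ _ hpw, Mem.set_val_of_ne _ _ (hyw τ), Mem.currentEntry]
    have hne : ∀ τ' ≠ τ, μ₁.val i (y τ') = μ.val i (y τ') := fun τ' h => by
      simp only [hμ₁, List.foldl_cons, List.foldl_nil, exec, Mem.set_val_of_ne _ _ (hy.ne h),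
        Mem.set_val_of_ne _ _ (hyw τ')]
    have hp : μ₁.val i p = μ.val i p := hF.keep p (by simp [hpw, hyp])
    have hcur : ∀ α, μ₁.currentEntry i α = μ.currentEntry i α := fun α => by
      simp only [Mem.currentEntry, hF.pos]
    obtain ⟨h1, h2⟩ := ih hl μ₁
    simp only [List.flatMap_cons, List.foldl_append]
    refine ⟨hF.trans h1, fun τ' => ?_⟩
    rw [h2 τ', hp, hF.index, hcur]
    by_cases h : τ' = τ
    · subst h
      simp [hτ, hself]
    · simp [hne τ' h, h]

end Rows

section FullProgram

variable {L m : ℕ} {s : ∀ i, Fin L → Fin (M.reg i)} {y : ∀ i, Fin M.idx → Fin (M.reg i)}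
  {p w : ∀ i, Fin (M.reg i)}

/-- The program for one symbol: add the contribution of the symbol to every sketch.  The registers
`s i` hold the point at which the sketches `y i` are evaluated. -/
def sketchProg {f L t : ℕ} {K : Fin f → Type} [∀ i, Field (K i)] {reg : Fin f → ℕ}
    (s : ∀ i, Fin L → Fin (reg i)) (y : ∀ i, Fin t → Fin (reg i)) (p w : ∀ i, Fin (reg i)) :
    List (UpdateInstr K reg t) :=
  (List.finRange f).flatMap fun i => pointProg i (s i) (p i) (w i) t ++ rowProg i (y i) (p i) (w i)

lemma length_sketchProg {f L t : ℕ} {K : Fin f → Type} [∀ i, Field (K i)] {reg : Fin f → ℕ}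
    (s : ∀ i, Fin L → Fin (reg i)) (y : ∀ i, Fin t → Fin (reg i)) (p w : ∀ i, Fin (reg i)) :
    (sketchProg (K := K) s y p w).length = f * (1 + 3 * L + 3 * t) := by
  simp only [sketchProg, pointProg, rowProg, List.length_flatMap, List.length_append,
    List.length_cons, List.length_nil, List.map_const', List.length_finRange,
    List.sum_replicate, smul_eq_mul]
  ring

/-- The registers of the program are pairwise distinct. -/
structure Separated (s : ∀ i, Fin L → Fin (M.reg i)) (y : ∀ i, Fin M.idx → Fin (M.reg i))
    (p w : ∀ i, Fin (M.reg i)) : Prop where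
  pw : ∀ i, p i ≠ w i
  sp : ∀ i j, s i j ≠ p i
  sw : ∀ i j, s i j ≠ w i
  yp : ∀ i τ, y i τ ≠ p i
  yw : ∀ i τ, y i τ ≠ w i
  sy : ∀ i j τ, s i j ≠ y i τ
  inj : ∀ i, Function.Injective (y i)

/-- The effect of one symbol on the sketches in the field `K i`. -/
def Mem.contribution (μ : M.Mem) (s : ∀ i, Fin L → Fin (M.reg i)) (a : Fin m) (i : Fin M.f)
    (τ : Fin M.idx) : M.K i :=
  μ.currentEntry i (μ.index τ) * ∏ j : Fin L, (digitVal (M.K i) a j + μ.val i (s i j))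

lemma exec_fields (hsep : Separated s y p w) (a : Fin m) (l : List (Fin M.f)) (hl : l.Nodup)
    (μ : M.Mem) :
    let μ' := (l.flatMap fun i => pointProg i (s i) (p i) (w i) M.idx ++
      rowProg i (y i) (p i) (w i)).foldl (M.exec a) μ
    μ'.index = μ.index ∧ μ'.pos = μ.pos ∧ (∀ i ∉ l, μ'.val i = μ.val i) ∧
      (∀ i j, μ'.val i (s i j) = μ.val i (s i j)) ∧
      ∀ i ∈ l, ∀ τ, μ'.val i (y i τ) = μ.val i (y i τ) + μ.contribution s a i τ := by
  induction l generalizing μ with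
  | nil => simp
  | cons i l ih =>
    obtain ⟨hi, hl⟩ := List.nodup_cons.mp hl
    obtain ⟨hF₁, hp⟩ := exec_pointProg (hsep.pw i) (hsep.sp i) (hsep.sw i) a μ
    set μ₁ := (pointProg i (s i) (p i) (w i) M.idx).foldl (M.exec a) μ
    obtain ⟨hF₂, hy⟩ := exec_rows (hsep.pw i) (hsep.yp i) (hsep.yw i) (hsep.inj i) a
      (List.finRange M.idx) (List.nodup_finRange _) μ₁
    set μ₂ := (rowProg i (y i) (p i) (w i)).foldl (M.exec a) μ₁ with hμ₂
    change Mem.Frame i _ μ₁ μ₂ at hF₂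
    change ∀ τ, μ₂.val i (y i τ) = _ at hy
    obtain ⟨hidx, hpos, hout, hs, hin⟩ := ih hl μ₂
    have hs₂ : ∀ i' j, μ₂.val i' (s i' j) = μ.val i' (s i' j) := by
      intro i' j
      by_cases h : i' = i
      · subst h
        rw [hF₂.keep _ (by
            simp only [Set.mem_compl_iff, Set.mem_insert_iff, Set.mem_range, not_or, not_exists]
            exact ⟨hsep.sw i' j, fun τ => (hsep.sy i' j τ).symm⟩),
          hF₁.keep _ (by simp [hsep.sp, hsep.sw])]
      · rw [hF₂.other _ h, hF₁.other _ h]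
    have hidx₂ : μ₂.index = μ.index := hF₂.index.trans hF₁.index
    have hpos₂ : μ₂.pos = μ.pos := hF₂.pos.trans hF₁.pos
    simp only [List.flatMap_cons, List.foldl_append]
    refine ⟨hidx.trans hidx₂, hpos.trans hpos₂, fun i' h => ?_,
      fun i' j => (hs i' j).trans (hs₂ i' j), fun i' h τ => ?_⟩
    · rw [List.mem_cons, not_or] at h
      exact (hout i' h.2).trans ((hF₂.other i' h.1).trans (hF₁.other i' h.1))
    · by_cases hii : i' = i
      · subst hii
        refine (congrFun (hout i' hi) _).trans ?_
        rw [hy τ, if_pos (List.mem_finRange τ), hF₁.keep _ (by simp [hsep.yp, hsep.yw]), hp,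
          hF₁.index]
        simp only [Mem.contribution, Mem.currentEntry, hF₁.pos]
      · have hil : i' ∈ l := (List.mem_cons.mp h).resolve_left hii
        refine (hin i' hil τ).trans ?_
        simp only [Mem.contribution, Mem.currentEntry, hpos₂, hidx₂, hs₂]
        rw [hF₂.other _ hii, hF₁.other _ hii]

/-- What the verifier knows after it has read the stream `σ`: the sketches are linear combinations
of the values that belong to the symbols of the stream. -/
theorem foldl_update_spec (hsep : Separated s y p w) (hprog : M.prog = sketchProg s y p w)
    (σ : Fin n → Fin m) (μ : M.Mem) (hpos : μ.pos = 0) :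
    let μ' := (List.ofFn σ).foldl M.update μ
    μ'.index = μ.index ∧ (∀ i j, μ'.val i (s i j) = μ.val i (s i j)) ∧
      ∀ i τ, μ'.val i (y i τ) = μ.val i (y i τ) +
        ∑ k, M.G i (μ.index τ) k * ∏ j : Fin L, (digitVal (M.K i) (σ k) j + μ.val i (s i j)) := by
  classical
  intro μ'
  have key := List.foldl_finRange_induction (fun (μ : M.Mem) k => M.update μ (σ k))
    (fun k μ' => μ'.pos.val = k ∧ μ'.index = μ.index ∧
      (∀ i j, μ'.val i (s i j) = μ.val i (s i j)) ∧
      ∀ i τ, μ'.val i (y i τ) = μ.val i (y i τ) + ∑ k' : Fin n with k'.val < k,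
        M.G i (μ.index τ) k' * ∏ j : Fin L, (digitVal (M.K i) (σ k') j + μ.val i (s i j))) μ
    (by simp [hpos]) (by
      rintro k μ₁ ⟨hpos₁, hidx₁, hs₁, hy₁⟩
      obtain ⟨hidx, hpos, -, hs, hy⟩ := exec_fields hsep (σ k) (List.finRange M.f)
        (List.nodup_finRange _) μ₁
      have hupd : M.update μ₁ (σ k) = (((List.finRange M.f).flatMap fun i =>
          pointProg i (s i) (p i) (w i) M.idx ++
            rowProg i (y i) (p i) (w i)).foldl (M.exec (σ k)) μ₁).advance := by
        rw [UpdateMachine.update, hprog, sketchProg]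
      rw [hupd]
      refine ⟨?_, hidx.trans hidx₁, fun i j => (hs i j).trans (hs₁ i j), fun i τ => ?_⟩
      · simp only [Mem.advance, hpos, hpos₁]
        exact min_eq_left k.isLt
      · refine (hy i (List.mem_finRange i) τ).trans ?_
        have hfil : (Finset.univ.filter fun k' : Fin n => k'.val < k.val + 1) =
            insert k (Finset.univ.filter fun k' : Fin n => k'.val < k.val) := by
          ext k'
          simp only [Finset.mem_filter_univ, Finset.mem_insert, Fin.ext_iff]
          omega
        rw [hfil, Finset.sum_insert (by simp), hy₁]
        simp only [Mem.contribution, Mem.currentEntry, hpos₁, k.isLt, dif_pos, hidx₁, hs₁]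
        ring)
  have hμ' : μ' = (List.finRange n).foldl (fun (μ : M.Mem) k => M.update μ (σ k)) μ := by
    simp only [μ', List.ofFn_eq_map, List.foldl_map]
  rw [hμ']
  obtain ⟨-, h1, h2, h3⟩ := key
  refine ⟨h1, h2, fun i τ => ?_⟩
  rw [h3 i τ]
  simp

end FullProgram

end UpdateMachine

/-! ### A verifier for the sum-check protocol that works bit by bit -/

/-- The value at `x` of the polynomial with the coefficients `cs`, leading coefficient first. -/
def horner {R : Type*} [CommRing R] (x : R) (cs : List R) : R :=
  cs.foldl (fun a c => a * x + c) 0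

/-- The ingredients of a verifier that keeps a memory `Mem` which is fixed after the stream has been
read, and then runs the sum-check protocol over the ring `R`.  A prover message consists of `D + 1`
elements of `R`, each encoded by `B` bits. -/
structure SumCheckData (m d : ℕ) (Mem R : Type) where
  /-- number of bits the verifier sends in the first round -/
  A : ℕ
  /-- number of bits of an element of `R` -/
  B : ℕ
  /-- degree of the polynomials sent by the prover -/
  D : ℕ
  B_pos : 0 < B
  init : PMF Mem
  update : Mem → Fin m → Mem
  /-- the sequence of bits that the verifier sends, regardless of the answers -/
  bit : Mem → ℕ → Bool
  decode : (Fin B → Bool) → R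
  /-- the random points of the sum-check protocol -/
  point : Mem → Fin d → R
  /-- the value that the last message has to match -/
  final : Mem → R
  /-- the answer, computed from the claimed sum -/
  result : R → Option ℕ

namespace SumCheckData

variable {m d : ℕ} {Mem R : Type}

/-- The part of the state that changes with every symbol received. -/
@[ext]
structure Acc (R : Type) (d D : ℕ) where
  /-- partial evaluation of the current polynomial at `-1` -/
  atNegOne : R
  /-- partial evaluation of the current polynomial at the random point -/
  atPoint : R
  /-- number of coefficients of the current polynomial received -/
  coef : Fin (D + 1)
  /-- number of complete rounds -/
  round : Fin (d + 1)
  /-- the value of the previous polynomial at the random point -/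
  claim : R
  /-- the sum that the prover claimed in the first round -/
  sum : R
  /-- whether all checks were successful -/
  ok : Bool

/-- The state of the verifier during the interaction.  `T` bounds the number of bits it sends. -/
structure State (Mem R : Type) (d T B D : ℕ) where
  mem : Mem
  /-- number of bits sent -/
  sent : Fin (T + 1)
  /-- number of bits of the current symbol received -/
  bitPos : Fin B
  buffer : Fin B → Bool
  acc : Acc R d D

/-- The components of a state. -/
def State.toProd {T B D : ℕ} (s : State Mem R d T B D) :
    Mem × Fin (T + 1) × Fin B × (Fin B → Bool) × R × R × Fin (D + 1) × Fin (d + 1) × R × R × Bool :=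
  (s.mem, s.sent, s.bitPos, s.buffer, s.acc.atNegOne, s.acc.atPoint, s.acc.coef,
    s.acc.round, s.acc.claim, s.acc.sum, s.acc.ok)

lemma State.toProd_injective {T B D : ℕ} :
    Function.Injective (State.toProd : State Mem R d T B D → _) := by
  rintro ⟨_, _, _, _, _⟩ ⟨_, _, _, _, _⟩ h
  simp_all [State.toProd, Acc.ext_iff]

/-- The elements of `R` that are encoded by a message. -/
def symbols (S : SumCheckData m d Mem R) (P : Fin ((S.D + 1) * S.B) → Bool) : List R :=
  List.ofFn fun i : Fin (S.D + 1) => S.decode fun j : Fin S.B =>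
    P ⟨i * S.B + j, by nlinarith [i.isLt, j.isLt]⟩

lemma length_symbols (S : SumCheckData m d Mem R) (P : Fin ((S.D + 1) * S.B) → Bool) :
    (S.symbols P).length = S.D + 1 := by
  simp [symbols]

variable [CommRing R] (S : SumCheckData m d Mem R)

/-- Upper bound for the number of bits sent by the verifier. -/
def T : ℕ := S.A + d * S.B

open Classical in
/-- Process a coefficient `c` of the current polynomial.  When `c` is the last one, it is the value
of the polynomial at `0`, and the checks of this round are made. -/
noncomputable def step (μ : Mem) (a : Acc R d S.D) (c : R) : Acc R d S.D :=
  let e := a.atNegOne * (-1) + c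
  let p := a.atPoint * (if h : a.round.val < d then S.point μ ⟨a.round.val, h⟩ else 0) + c
  if h : a.coef.val < S.D then
    { a with atNegOne := e, atPoint := p, coef := ⟨a.coef.val + 1, by omega⟩ }
  else
    { atNegOne := 0
      atPoint := 0
      coef := 0
      round := ⟨min (a.round.val + 1) d, by omega⟩
      claim := p
      sum := if a.round.val = 0 then c + e else a.sum
      ok := a.ok && decide (a.round.val = 0 ∨ c + e = a.claim) }

/-- Consume one bit: it is put into the buffer, and a full buffer is processed. -/
noncomputable def recv (s : State Mem R d S.T S.B S.D) (b : Bool) : State Mem R d S.T S.B S.D :=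
  let buf := Function.update s.buffer s.bitPos b
  if h : s.bitPos.val + 1 < S.B then
    { s with bitPos := ⟨s.bitPos.val + 1, h⟩, buffer := buf }
  else
    { s with bitPos := ⟨0, S.B_pos⟩, buffer := buf, acc := S.step s.mem s.acc (S.decode buf) }

/-- The state before the interaction. -/
def start (μ : Mem) : State Mem R d S.T S.B S.D where
  mem := μ
  sent := 0
  bitPos := ⟨0, S.B_pos⟩
  buffer := fun _ => false
  acc := ⟨0, 0, 0, 0, 0, 0, true⟩

open Classical in
/-- The verifier of the sum-check protocol. -/
noncomputable def verifier [Finite Mem] [Finite R] : SIPVerifier m d where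
  State := State Mem R d S.T S.B S.D
  finite_state := Finite.of_injective _ State.toProd_injective
  init := S.init.map S.start
  update s a := { s with mem := S.update s.mem a }
  vlen j := if j.val = 0 then S.A else S.B
  plen _ := (S.D + 1) * S.B
  send s := (S.bit s.mem s.sent, { s with sent := ⟨min (s.sent.val + 1) S.T, by omega⟩ })
  recv := S.recv
  output s := if s.acc.ok = true ∧ s.acc.claim = S.final s.mem then S.result s.acc.sum else none


section Semantics

variable {S}

lemma foldl_step_of_le {μ : Mem} {a : Acc R d S.D} {r : R}
    (hr : r = if h : a.round.val < d then S.point μ ⟨a.round.val, h⟩ else 0)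
    (l : List R) (hl : a.coef.val + l.length ≤ S.D) :
    l.foldl (S.step μ) a =
      { a with
        atNegOne := l.foldl (fun e c => e * (-1) + c) a.atNegOne
        atPoint := l.foldl (fun e c => e * r + c) a.atPoint
        coef := ⟨a.coef.val + l.length, by omega⟩ } := by
  induction l generalizing a with
  | nil => rfl
  | cons c l ih =>
    rw [List.length_cons] at hl
    have hstep : S.step μ a c =
        { a with
          atNegOne := a.atNegOne * (-1) + c
          atPoint := a.atPoint * r + c
          coef := ⟨a.coef.val + 1, by omega⟩ } := by
      rw [step, dif_pos (by omega), hr]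
    rw [List.foldl_cons, hstep, ih (by exact hr) (by simp only; omega)]
    simp only [List.foldl_cons, List.length_cons, Acc.mk.injEq, true_and, and_true, Fin.mk.injEq]
    omega

/-- The effect of a complete message `cs` in the round `j`. -/
lemma foldl_step_message {μ : Mem} {a : Acc R d S.D} (j : Fin d) (hj : a.round.val = j)
    (h0 : a.coef = 0) (hn : a.atNegOne = 0) (hp : a.atPoint = 0) (cs : List R)
    (hcs : cs.length = S.D + 1) :
    ∃ a', cs.foldl (S.step μ) a = a' ∧ a'.round.val = j.val + 1 ∧ a'.coef = 0 ∧ a'.atNegOne = 0 ∧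
      a'.atPoint = 0 ∧ a'.claim = horner (S.point μ j) cs ∧
      a'.sum = (if j.val = 0 then horner 0 cs + horner (-1) cs else a.sum) ∧
      (a'.ok = true ↔
        a.ok = true ∧ (j.val = 0 ∨ horner 0 cs + horner (-1) cs = a.claim)) := by
  obtain ⟨l, c, rfl⟩ : ∃ l c, cs = l ++ [c] :=
    ⟨_, _, (List.dropLast_append_getLast (List.ne_nil_of_length_pos (by omega))).symm⟩
  have hl : l.length = S.D := by simpa using hcs
  have hr : S.point μ j = if h : a.round.val < d then S.point μ ⟨a.round.val, h⟩ else 0 := by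
    rw [dif_pos (hj ▸ j.isLt)]
    congr 1
    exact Fin.ext hj.symm
  -- the coefficients arrive in decreasing order, so that the last one is the value at `0`
  have hlast : horner 0 (l ++ [c]) = c := by simp [horner]
  refine ⟨_, rfl, ?_⟩
  rw [List.foldl_append, foldl_step_of_le hr l (by simp [h0, hl]), List.foldl_cons, List.foldl_nil,
    step, dif_neg (by simp [hl, h0])]
  simp only [hj, j.isLt, hn, hp, hlast, dif_pos, Bool.and_eq_true, decide_eq_true_eq]
  refine ⟨min_eq_left j.isLt, trivial, trivial, trivial, ?_, ?_, ?_⟩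
  · simp [horner]
  · simp [horner]
  · simp [horner]

/-- When the first bits of the block `w` are in the buffer and the others are received, then the
symbol encoded by `w` is processed. -/
lemma foldl_recv_drop (w : Fin S.B → Bool) (k : ℕ) (s : State Mem R d S.T S.B S.D)
    (hk : s.bitPos.val + (k + 1) = S.B) (hs : ∀ i < s.bitPos, s.buffer i = w i) :
    ((List.ofFn w).drop s.bitPos).foldl S.recv s =
      { s with
        bitPos := ⟨0, S.B_pos⟩
        buffer := w
        acc := S.step s.mem s.acc (S.decode w) } := by
  have hbuf : ∀ i ≤ s.bitPos, Function.update s.buffer s.bitPos (w s.bitPos) i = w i := by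
    intro i hi
    rcases hi.eq_or_lt with rfl | hi
    · simp
    · rw [Function.update_of_ne hi.ne, hs i hi]
  rw [List.drop_eq_getElem_cons (by simp), List.foldl_cons, List.getElem_ofFn]
  induction k generalizing s with
  | zero =>
    have hw : Function.update s.buffer s.bitPos (w s.bitPos) = w :=
      funext fun i => hbuf i (Fin.le_def.mpr (by omega))
    rw [List.drop_eq_nil_of_le (by simp; omega), List.foldl_nil]
    simp only [recv, Fin.eta, hw]
    rw [dif_neg (by omega)]
  | succ k ih =>
    have hlt : s.bitPos.val + 1 < S.B := by omega
    have hrec : S.recv s (w s.bitPos) =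
        { s with
          bitPos := ⟨s.bitPos.val + 1, hlt⟩
          buffer := Function.update s.buffer s.bitPos (w s.bitPos) } := by
      rw [recv, dif_pos hlt]
    simp only [Fin.eta]
    rw [hrec]
    set s' : State Mem R d S.T S.B S.D :=
        { s with
          bitPos := ⟨s.bitPos.val + 1, hlt⟩
          buffer := Function.update s.buffer s.bitPos (w s.bitPos) } with hs'
    have hs1 : ∀ i < s'.bitPos, s'.buffer i = w i := fun i hi => hbuf i (Nat.lt_succ_iff.mp hi)
    have hbuf' : ∀ i ≤ s'.bitPos,
        Function.update s'.buffer s'.bitPos (w s'.bitPos) i = w i := by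
      intro i hi
      rcases hi.eq_or_lt with rfl | hi
      · simp
      · rw [Function.update_of_ne hi.ne, hs1 i hi]
    have := ih s' (by simp only [hs']; omega) hs1 hbuf'
    rw [show s.bitPos.val + 1 = s'.bitPos.val from rfl, List.drop_eq_getElem_cons (by simp),
      List.foldl_cons, List.getElem_ofFn, this]

lemma foldl_recv_blocks (ws : List (Fin S.B → Bool)) (s : State Mem R d S.T S.B S.D)
    (hs : s.bitPos = ⟨0, S.B_pos⟩) : ∃ buf, (ws.map List.ofFn).flatten.foldl S.recv s =
      { s with buffer := buf, acc := (ws.map S.decode).foldl (S.step s.mem) s.acc } := by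
  induction ws generalizing s with
  | nil => exact ⟨s.buffer, rfl⟩
  | cons w ws ih =>
    have hB := S.B_pos
    have h0 : s.bitPos.val = 0 := by rw [hs]
    have h := foldl_recv_drop w (S.B - 1) s (by omega)
      (fun i hi => absurd (Fin.lt_def.mp hi) (by omega))
    rw [h0, List.drop_zero] at h
    rw [List.map_cons, List.flatten_cons, List.foldl_append, h]
    obtain ⟨buf, hbuf⟩ := ih { s with
        bitPos := ⟨0, S.B_pos⟩
        buffer := w
        acc := S.step s.mem s.acc (S.decode w) } rfl
    refine ⟨buf, hbuf.trans ?_⟩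
    simp only [State.mk.injEq, true_and, List.map_cons, List.foldl_cons, and_true]
    exact hs.symm

lemma foldl_recv_message (P : Fin ((S.D + 1) * S.B) → Bool) (s : State Mem R d S.T S.B S.D)
    (hs : s.bitPos = ⟨0, S.B_pos⟩) : ∃ buf, (List.ofFn P).foldl S.recv s =
      { s with buffer := buf, acc := (S.symbols P).foldl (S.step s.mem) s.acc } := by
  obtain ⟨buf, h⟩ := foldl_recv_blocks (List.ofFn fun i : Fin (S.D + 1) => fun j : Fin S.B =>
    P ⟨i * S.B + j, by nlinarith [i.isLt, j.isLt]⟩) s hs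
  refine ⟨buf, ?_⟩
  rw [List.ofFn_mul, symbols]
  rw [List.map_ofFn, List.map_ofFn] at h
  exact h

variable [Finite Mem] [Finite R]

lemma emit_eq (k : ℕ) (s : State Mem R d S.T S.B S.D) (h : s.sent.val + k ≤ S.T) :
    S.verifier.emit k s = ((List.range' s.sent k).map (S.bit s.mem),
      { s with sent := ⟨s.sent.val + k, by omega⟩ }) := by
  induction k generalizing s with
  | zero => rfl
  | succ k ih =>
    let s₁ : State Mem R d S.T S.B S.D := { s with sent := ⟨s.sent.val + 1, by omega⟩ }
    have hsend : S.verifier.send s = (S.bit s.mem s.sent, s₁) := by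
      have h1 : min (s.sent.val + 1) S.T = s.sent.val + 1 := by omega
      simp only [verifier, h1, s₁]
    have hs₁ := ih s₁ (by simp only [s₁]; omega)
    simp only [SIPVerifier.emit]
    erw [hsend]
    simp only
    erw [hs₁]
    simp only [s₁, List.range'_succ, List.map_cons, Nat.add_assoc, Nat.add_comm 1 k]

/-- The number of bits the verifier sends in the first `j` rounds. -/
def sentBits (S : SumCheckData m d Mem R) : ℕ → ℕ
  | 0 => 0
  | j + 1 => S.A + j * S.B

/-- The bits the prover has received when he sends his message in round `j`. -/
def history (S : SumCheckData m d Mem R) (μ : Mem) (j : ℕ) : List Bool :=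
  (List.range (S.sentBits (j + 1))).map (S.bit μ)

/-- The coefficients sent by the prover in round `j`. -/
noncomputable def message (S : SumCheckData m d Mem R) (P : S.verifier.Strategy) (μ : Mem)
    (j : Fin d) : List R :=
  S.symbols (P j (S.history μ j))

/-- The verifier is convinced by the polynomials with the coefficients `cs`. -/
def Convinced (S : SumCheckData m d Mem R) (μ : Mem) (cs : Fin d → List R) : Prop :=
  (∀ k k' : Fin d, k'.val = k.val + 1 →
    horner 0 (cs k') + horner (-1) (cs k') = horner (S.point μ k) (cs k)) ∧
  ∀ k : Fin d, k.val + 1 = d → horner (S.point μ k) (cs k) = S.final μ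

lemma foldl_round_invariant (P : S.verifier.Strategy) (μ : Mem) :
    let c := (List.finRange d).foldl (S.verifier.round P) ([], S.start μ)
    let s : State Mem R d S.T S.B S.D := c.2
    s.mem = μ ∧
      (∀ j : Fin d, j.val + 1 = d → s.acc.claim = horner (S.point μ j) (S.message P μ j)) ∧
      (∀ j : Fin d, j.val = 0 →
        s.acc.sum = horner 0 (S.message P μ j) + horner (-1) (S.message P μ j)) ∧
      (s.acc.ok = true ↔ ∀ k k' : Fin d, k'.val = k.val + 1 →
        horner 0 (S.message P μ k') + horner (-1) (S.message P μ k') =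
          horner (S.point μ k) (S.message P μ k)) := by
  have key := List.foldl_finRange_induction (S.verifier.round P)
    (fun k (c : List Bool × State Mem R d S.T S.B S.D) =>
      (c.1 = (List.range (S.sentBits k)).map (S.bit μ) ∧ c.2.mem = μ ∧
        c.2.sent.val = S.sentBits k ∧ c.2.bitPos = ⟨0, S.B_pos⟩ ∧ c.2.acc.round.val = k ∧
        c.2.acc.coef = 0 ∧ c.2.acc.atNegOne = 0 ∧ c.2.acc.atPoint = 0) ∧
      (∀ j : Fin d, j.val + 1 = k →
        c.2.acc.claim = horner (S.point μ j) (S.message P μ j)) ∧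
      (∀ j : Fin d, j.val = 0 → 0 < k → c.2.acc.sum =
        horner 0 (S.message P μ j) + horner (-1) (S.message P μ j)) ∧
      (c.2.acc.ok = true ↔ ∀ i i' : Fin d, i'.val = i.val + 1 → i'.val < k →
        horner 0 (S.message P μ i') + horner (-1) (S.message P μ i') =
          horner (S.point μ i) (S.message P μ i)))
    ([], S.start μ) (by simp [start, sentBits]) (by
      rintro j ⟨hist, s⟩ ⟨⟨hh, hmem, hsent, hbit, hround, hcoef, hneg, hpt⟩, hclaim, hsum, hok⟩
      simp only at hh hmem hsent hbit hround hcoef hneg hpt hclaim hsum hok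
      have hvlen : S.sentBits j + S.verifier.vlen j = S.sentBits (j + 1) := by
        rcases hj : j.val with _ | k
        · simp [sentBits, verifier, hj]
        · simp [sentBits, verifier, hj]
          ring
      have hT : S.sentBits (j + 1) ≤ S.T := by
        simp only [sentBits, T]
        have := Nat.mul_le_mul_right S.B j.isLt.le
        omega
      have hemit := emit_eq (S.verifier.vlen j) s (by omega)
      have hhist : hist ++ (List.range' s.sent (S.verifier.vlen j)).map (S.bit s.mem) =
          S.history μ j := by
        rw [hh, hmem, hsent, ← List.map_append, history, List.range_eq_range',
          List.range_eq_range', ← hvlen, ← List.range'_append_1, Nat.zero_add]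
      obtain ⟨buf, hrecv⟩ := foldl_recv_message (P j (S.history μ j))
        { s with sent := ⟨s.sent.val + S.verifier.vlen j, by omega⟩ } hbit
      obtain ⟨a', ha', hround', hcoef', hneg', hpt', hclaim', hsum', hok'⟩ :=
        foldl_step_message (μ := s.mem) j hround hcoef hneg hpt
          (S.symbols (P j (S.history μ j))) (length_symbols _ _)
      have hrnd : S.verifier.round P (hist, s) j = (S.history μ j,
          ({ s with
            sent := ⟨s.sent.val + S.verifier.vlen j, by omega⟩
            buffer := buf
            acc := a' } : State Mem R d S.T S.B S.D)) := by
        unfold SIPVerifier.round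
        simp only
        erw [hemit]
        simp only [hhist]
        erw [hrecv]
        rw [← ha']
        rfl
      rw [hrnd]
      rw [hmem] at hclaim'
      refine ⟨⟨rfl, hmem, by simp only [hsent, hvlen], hbit, hround', hcoef', hneg', hpt'⟩,
        fun i hi => ?_, fun i hi _ => ?_, ?_⟩
      · obtain rfl : i = j := Fin.ext (by omega)
        exact hclaim'
      · by_cases hj : j.val = 0
        · obtain rfl : i = j := Fin.ext (by omega)
          exact hsum'.trans (if_pos hj)
        · rw [if_neg hj] at hsum'
          exact hsum'.trans (hsum i hi (by omega))
      · refine hok'.trans ?_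
        rw [hok]
        constructor
        · rintro ⟨h1, h2⟩ i i' hii hi'
          rcases Nat.lt_succ_iff_lt_or_eq.mp hi' with hi' | hi'
          · exact h1 i i' hii hi'
          · obtain rfl : i' = j := Fin.ext hi'
            rw [← hclaim i (by omega)]
            exact h2.resolve_left (by omega)
        · intro h
          refine ⟨fun i i' hii hi' => h i i' hii (by omega), ?_⟩
          by_cases hj : j.val = 0
          · exact Or.inl hj
          · refine Or.inr ?_
            rw [hclaim ⟨j.val - 1, by omega⟩ (by simp only; omega)]
            exact h ⟨j.val - 1, by omega⟩ j (by simp only; omega) (by omega))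
  obtain ⟨⟨-, hmem, -⟩, hclaim, hsum, hok⟩ := key
  refine ⟨hmem, hclaim, fun j hj => hsum j hj j.pos, hok.trans ?_⟩
  exact forall₂_congr fun k k' => by simp [k'.isLt]

open Classical in
/-- The answer of the verifier in terms of the polynomials sent by the prover. -/
theorem answer_start {n : ℕ} (σ : Fin n → Fin m) (P : S.verifier.Strategy) (μ₀ : Mem) (j₀ : Fin d)
    (hj₀ : j₀.val = 0) :
    let μ := (List.ofFn σ).foldl S.update μ₀
    S.verifier.answer σ P (S.start μ₀) = if S.Convinced μ (S.message P μ) then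
      S.result (horner 0 (S.message P μ j₀) + horner (-1) (S.message P μ j₀)) else none := by
  intro μ
  have hread : S.verifier.readStream σ (S.start μ₀) = S.start μ := by
    simp only [SIPVerifier.readStream, μ]
    generalize List.ofFn σ = l
    induction l generalizing μ₀ with
    | nil => rfl
    | cons a l ih => exact ih (S.update μ₀ a)
  obtain ⟨hmem, hclaim, hsum, hok⟩ := foldl_round_invariant P μ
  change S.verifier.output ((List.finRange d).foldl (S.verifier.round P)
    ([], S.verifier.readStream σ (S.start μ₀))).2 = _
  rw [hread]
  set c := (List.finRange d).foldl (S.verifier.round P) ([], S.start μ)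
  change (if (State.acc c.2).ok = true ∧ _ then S.result (State.acc c.2).sum else none) = _
  refine if_congr ?_ (congrArg S.result (hsum j₀ hj₀)) rfl
  rw [Convinced, hok, hmem]
  refine and_congr_right fun _ => ⟨fun h k hk => (hclaim k hk).symm.trans h, fun h => ?_⟩
  have hd := j₀.pos
  rw [hclaim ⟨d - 1, by omega⟩ (by simp only; omega)]
  exact h _ (by simp only; omega)

end Semantics

end SumCheckData

/-! ### Polynomials given by coefficient lists -/

section CoeffPoly

open Polynomial

variable {K : Type*} [Field K]

/-- The polynomial with the coefficients `cs`, leading coefficient first. -/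
noncomputable def coeffPoly (cs : List K) : K[X] := cs.foldl (fun a c => a * X + C c) 0

lemma coeffPoly_append_singleton (cs : List K) (c : K) :
    coeffPoly (cs ++ [c]) = coeffPoly cs * X + C c := by
  simp [coeffPoly]

lemma eval_coeffPoly (x : K) (cs : List K) : (coeffPoly cs).eval x = horner x cs := by
  induction cs using List.reverseRecOn with
  | nil => simp [coeffPoly, horner]
  | append_singleton cs c ih =>
    rw [coeffPoly_append_singleton, eval_add, eval_mul, eval_X, eval_C, ih]
    simp [horner]

lemma natDegree_coeffPoly_le (cs : List K) : (coeffPoly cs).natDegree ≤ cs.length - 1 := by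
  induction cs using List.reverseRecOn with
  | nil => simp [coeffPoly]
  | append_singleton cs c ih =>
    rw [coeffPoly_append_singleton, natDegree_add_C]
    rcases cs.eq_nil_or_concat with rfl | ⟨l, b, rfl⟩
    · simp [coeffPoly]
    · refine natDegree_mul_le.trans ?_
      simp at ih ⊢
      omega

lemma exists_coeffPoly_eq (D : ℕ) (q : K[X]) (hq : q.natDegree ≤ D) :
    ∃ cs : List K, cs.length = D + 1 ∧ coeffPoly cs = q := by
  induction D generalizing q with
  | zero =>
    refine ⟨[q.coeff 0], rfl, ?_⟩
    rw [eq_C_of_natDegree_le_zero hq]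
    simp [coeffPoly]
  | succ D ih =>
    obtain ⟨cs, hcs, hcs'⟩ := ih q.divX (by rw [natDegree_divX_eq_natDegree_tsub_one]; omega)
    refine ⟨cs ++ [q.coeff 0], by simp [hcs], ?_⟩
    rw [coeffPoly_append_singleton, hcs', divX_mul_X_add]

lemma horner_pi_apply {ι : Type*} {K : ι → Type*} [∀ i, Field (K i)] (x : ∀ i, K i)
    (cs : List (∀ i, K i)) (i : ι) :
    horner x cs i = (coeffPoly (cs.map fun c => c i)).eval (x i) := by
  rw [eval_coeffPoly]
  induction cs using List.reverseRecOn with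
  | nil => rfl
  | append_singleton cs c ih =>
    simp only [horner, List.map_append, List.foldl_append] at ih ⊢
    simp [ih]

end CoeffPoly

/-! ### The polynomial that counts distinct elements -/

namespace Sketch

variable {m n L N t p : ℕ} {K : Type*} [Field K]

open UpdateMachine (digitVal)

/-- The point of the cube `{0, -1}ᴸ` that represents the element `x` of the universe. -/
def cubePoint (K : Type*) [Field K] (L : ℕ) (x : Fin m) : Fin L → K :=
  fun j => if x.val.testBit j then 0 else -1

lemma cubePoint_injective (hm : m ≤ 2 ^ L) :
    Function.Injective (cubePoint K L : Fin m → Fin L → K) := by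
  intro x y h
  refine Fin.ext (Nat.eq_of_testBit_eq fun j => ?_)
  by_cases hj : j < L
  · have := congrFun h ⟨j, hj⟩
    simp only [cubePoint] at this
    by_cases hx : x.val.testBit j <;> by_cases hy : y.val.testBit j <;> simp_all
  · have h2 : 2 ^ L ≤ 2 ^ j := Nat.pow_le_pow_right (by norm_num) (not_lt.mp hj)
    rw [Nat.testBit_lt_two_pow (by omega), Nat.testBit_lt_two_pow (by omega)]

open Classical in
/-- On the cube, the product of all `a_j + z_j` vanishes except at the point of `a`, where it is
`1` or `-1`. -/
lemma prod_digitVal_add {z : Fin L → K} (hz : ∀ j, z j = 0 ∨ z j = -1) (a : Fin m) :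
    ∏ j : Fin L, (digitVal K a j + z j) =
      if cubePoint K L a = z then ∏ j, (if z j = 0 then 1 else -1) else 0 := by
  split_ifs with h
  · subst h
    refine Finset.prod_congr rfl fun j _ => ?_
    by_cases hj : a.val.testBit j <;> simp [cubePoint, digitVal, hj]
  · obtain ⟨j, hj⟩ := Function.ne_iff.mp h
    refine Finset.prod_eq_zero (Finset.mem_univ j) ?_
    rcases hz j with h0 | h0 <;> by_cases hb : a.val.testBit j <;>
      simp_all [cubePoint, digitVal]

/-- The multilinear extension of the sketch of the stream `σ` for the row `α` of `G`: at the point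
of `x` it is, up to the sign, the sum of the entries in the columns where `x` occurs. -/
def sketch (L : ℕ) (φ : ZMod p →+* K) (G : Fin N → Fin n → ZMod p) (σ : Fin n → Fin m)
    (α : Fin N) (z : Fin L → K) : K :=
  ∑ k, φ (G α k) * ∏ j : Fin L, (digitVal K (σ k) j + z j)

/-- The disjunction of the conditions `sketch ≠ 0` for `t` rows, as a polynomial. -/
def occurs (L : ℕ) (φ : ZMod p →+* K) (G : Fin N → Fin n → ZMod p) (σ : Fin n → Fin m)
    (α : Fin t → Fin N) (z : Fin L → K) : K :=
  1 - ∏ τ, (1 - sketch L φ G σ (α τ) z ^ (p - 1))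

variable {φ : ZMod p →+* K} {G : Fin N → Fin n → ZMod p} {σ : Fin n → Fin m}

lemma coordDegreeLE_occurs (α : Fin t → Fin N) :
    CoordDegreeLE (t * (p - 1)) (occurs L φ G σ α) := by
  have hs : ∀ τ, CoordDegreeLE 1 (sketch L φ G σ (α τ)) := fun τ =>
    CoordDegreeLE.sum _ fun k _ => by
      simpa using (CoordDegreeLE.const _).mul
        (CoordDegreeLE.prod_const_add (K := K) fun j : Fin L => digitVal K (σ k) j)
  have := (CoordDegreeLE.prod Finset.univ fun τ _ => ((hs τ).pow (p - 1)).one_sub).one_sub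
  rwa [Finset.card_univ, Fintype.card_fin, mul_one] at this

/-- Every element of the stream is detected by one of the rows `α`. -/
def Good (G : Fin N → Fin n → ZMod p) (σ : Fin n → Fin m) (α : Fin t → Fin N) : Prop :=
  ∀ x ∈ Finset.univ.image σ, ∃ τ, ∑ k with σ k = x, G (α τ) k ≠ 0

open Classical in
/-- Up to the sign, the sketch is an element of the prime field at the points of the cube, so that
Fermat's little theorem applies. -/
lemma sketch_pow [Fact p.Prime] {z : Fin L → K} (hz : ∀ j, z j = 0 ∨ z j = -1) (α : Fin N) :
    sketch L φ G σ α z ^ (p - 1) =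
      if ∑ k with cubePoint K L (σ k) = z, G α k = 0 then 0 else 1 := by
  have hp := (Fact.out : p.Prime).two_le
  have hs : sketch L φ G σ α z =
      φ ((∏ j, (if z j = 0 then 1 else -1)) * ∑ k with cubePoint K L (σ k) = z, G α k) := by
    simp only [sketch, prod_digitVal_add hz, mul_ite, mul_zero]
    rw [← Finset.sum_filter, ← Finset.sum_mul, mul_comm, map_mul, map_sum, map_prod]
    congr 1
    refine Finset.prod_congr rfl fun j _ => ?_
    split_ifs <;> simp
  have hsign : (∏ j, (if z j = 0 then 1 else -1) : ZMod p) ≠ 0 :=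
    Finset.prod_ne_zero_iff.mpr fun j _ => by split_ifs <;> simp
  rw [hs, ← map_pow]
  split_ifs with h
  · rw [h, mul_zero, zero_pow (by omega), map_zero]
  · rw [ZMod.pow_card_sub_one_eq_one (mul_ne_zero hsign h), map_one]

/-- If the rows detect all elements, then the sum over the cube is the number of distinct
elements. -/
theorem partialSum_occurs [Fact p.Prime] (hm : m ≤ 2 ^ L) {α : Fin t → Fin N}
    (hα : Good G σ α) (r : Fin L → K) :
    SumCheck.partialSum (occurs L φ G σ α) 0 r = (distinctElements σ : K) := by
  classical
  set I := (Finset.univ.image σ).image (cubePoint K L) with hI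
  have hcube : ∀ z ∈ SumCheck.subcube 0 r, ∀ j, z j = 0 ∨ z j = -1 := fun z hz j =>
    (SumCheck.mem_subcube.mp hz j).2 (Nat.zero_le _)
  have hsub : I ⊆ SumCheck.subcube 0 r := by
    intro z hz
    obtain ⟨x, -, rfl⟩ := Finset.mem_image.mp hz
    refine SumCheck.mem_subcube.mpr fun j => ⟨fun h => absurd h (Nat.not_lt_zero _), fun _ => ?_⟩
    simp only [cubePoint]
    split_ifs <;> simp
  have h0 : ∀ z ∈ SumCheck.subcube 0 r, z ∉ I → occurs L φ G σ α z = 0 := by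
    intro z hz hzI
    have hempty : (Finset.univ.filter fun k => cubePoint K L (σ k) = z) = ∅ :=
      Finset.filter_eq_empty_iff.mpr fun k _ h => hzI (Finset.mem_image.mpr
        ⟨σ k, Finset.mem_image_of_mem σ (Finset.mem_univ k), h⟩)
    simp [occurs, sketch_pow (hcube z hz), hempty]
  have h1 : ∀ z ∈ I, occurs L φ G σ α z = 1 := by
    intro z hz
    have hz' := hcube z (hsub hz)
    obtain ⟨x, hx, rfl⟩ := Finset.mem_image.mp hz
    obtain ⟨τ, hτ⟩ := hα x hx
    rw [occurs, Finset.prod_eq_zero (Finset.mem_univ τ), sub_zero]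
    rw [sketch_pow hz', if_neg, sub_self]
    simpa only [(cubePoint_injective (K := K) hm).eq_iff] using hτ
  rw [SumCheck.partialSum, ← Finset.sum_subset hsub h0, Finset.sum_congr rfl h1, Finset.sum_const,
    nsmul_eq_mul, mul_one, hI, Finset.card_image_of_injective _ (cubePoint_injective hm),
    distinctElements]

open Classical in
/-- A random choice of the rows misses an element with probability at most `m / 2ᵗ`. -/
lemma card_not_good_mul_le (hG : ∀ s : Finset (Fin n), s.Nonempty →
      2 * Nat.card {α // ∑ k ∈ s, G α k = 0} ≤ N) (σ : Fin n → Fin m) (t : ℕ) :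
    (Finset.univ.filter fun α : Fin t → Fin N => ¬ Good G σ α).card * 2 ^ t ≤ m * N ^ t := by
  let Z : Fin m → Finset (Fin N) := fun x =>
    Finset.univ.filter fun α => ∑ k with σ k = x, G α k = 0
  have hsub : (Finset.univ.filter fun α : Fin t → Fin N => ¬ Good G σ α) ⊆
      (Finset.univ.image σ).biUnion fun x => Fintype.piFinset fun _ => Z x := by
    intro α hα
    have := (Finset.mem_filter.mp hα).2
    simp only [Good] at this
    push Not at this
    obtain ⟨x, hx, hx'⟩ := this
    exact Finset.mem_biUnion.mpr ⟨x, hx, by simpa [Z] using hx'⟩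
  have hZ : ∀ x ∈ Finset.univ.image σ,
      (Fintype.piFinset fun _ : Fin t => Z x).card * 2 ^ t ≤ N ^ t := by
    intro x hx
    obtain ⟨k, -, hk⟩ := Finset.mem_image.mp hx
    have h := hG (Finset.univ.filter fun k => σ k = x) ⟨k, by simpa using hk⟩
    rw [Nat.card_eq_fintype_card, Fintype.card_subtype] at h
    rw [Fintype.card_piFinset_const, ← mul_pow]
    exact Nat.pow_le_pow_left (by rw [mul_comm]; exact h) t
  calc _ ≤ (∑ x ∈ Finset.univ.image σ, (Fintype.piFinset fun _ : Fin t => Z x).card) * 2 ^ t :=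
        Nat.mul_le_mul_right _ ((Finset.card_le_card hsub).trans Finset.card_biUnion_le)
    _ = ∑ x ∈ Finset.univ.image σ, (Fintype.piFinset fun _ : Fin t => Z x).card * 2 ^ t :=
        Finset.sum_mul _ _ _
    _ ≤ ∑ _x ∈ Finset.univ.image σ, N ^ t := Finset.sum_le_sum hZ
    _ ≤ m * N ^ t := by
        rw [Finset.sum_const, smul_eq_mul]
        exact Nat.mul_le_mul_right _ ((Finset.card_le_univ _).trans_eq (Fintype.card_fin m))

end Sketch

/-! ### The verifier for the number of distinct elements -/

/-- The parameters of the protocol: the fields `K i` of characteristic `p i`, in which the sum-check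
protocol is run in parallel, the matrices `G i` agreed upon in advance, which have as many rows as
columns, the number `t` of random rows, the degree bound `D`, and encodings of the verifier's coins
by bits. -/
structure SketchSetup (m n L t : ℕ) where
  p : Fin L → ℕ
  K : Fin L → Type
  prime : ∀ i, Fact (p i).Prime
  field : ∀ i, Field (K i)
  fintype : ∀ i, Fintype (K i)
  φ : ∀ i, ZMod (p i) →+* K i
  G : ∀ i, Fin n → Fin n → ZMod (p i)
  /-- number of bits that encode the random rows -/
  A : ℕ
  /-- number of bits that encode a tuple of field elements -/
  B : ℕ
  /-- bound for the degree in each variable -/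
  D : ℕ
  encRows : (Fin t → Fin n) → Fin A → Bool
  encElt : (∀ i, K i) → Fin B → Bool
  n_pos : 0 < n
  L_pos : 0 < L
  B_pos : 0 < B
  D_pos : 0 < D
  le_two_pow : m ≤ 2 ^ L
  row_sum : ∀ i, ∀ s : Finset (Fin n), s.Nonempty → 2 * Nat.card {α // ∑ k ∈ s, G i α k = 0} ≤ n
  encRows_injective : Function.Injective encRows
  encElt_injective : Function.Injective encElt
  p_injective : Function.Injective p
  lt_prod : m < ∏ i, p i
  degree_le : ∀ i, t * (p i - 1) ≤ D
  /-- cheating in the sum-check protocol succeeds, in one of the fields, with probability at most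
  `1/6` -/
  le_card : ∀ i, 6 * L * (L * D) ≤ Fintype.card (K i)
  /-- the rows miss an element of the stream, in one of the fields, with probability at most `1/6` -/
  rows_large : 6 * (L * m) ≤ 2 ^ t

namespace SketchSetup

variable {m n L t : ℕ} (S : SketchSetup m n L t)

instance (i : Fin L) : Fact (S.p i).Prime := S.prime i
instance (i : Fin L) : Field (S.K i) := S.field i
instance (i : Fin L) : Fintype (S.K i) := S.fintype i

/-- The ring over which the sum-check protocol is run. -/
abbrev R : Type := ∀ i, S.K i

/-- The machine that processes the stream.  Over each field, the first `L` registers hold the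
random point, the next `t` registers the sketches, and two registers intermediate results. -/
def machine : UpdateMachine n where
  f := L
  K := S.K
  field := S.field
  finite i := @Finite.of_fintype _ (S.fintype i)
  reg _ := L + t + 2
  idx := t
  rows := n
  G i α k := S.φ i (S.G i α k)
  prog := UpdateMachine.sketchProg (reg := fun _ => L + t + 2)
    (fun _ (j : Fin L) => ⟨j, by omega⟩) (fun _ (τ : Fin t) => ⟨L + τ, by omega⟩)
    (fun _ => ⟨L + t, by omega⟩) (fun _ => ⟨L + t + 1, by omega⟩)

/-- The registers of the random point. -/
def pointReg (i : Fin S.machine.f) (j : Fin L) : Fin (S.machine.reg i) :=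
  (⟨j, by omega⟩ : Fin (L + t + 2))

/-- The registers of the sketches. -/
def sketchReg (i : Fin S.machine.f) (τ : Fin S.machine.idx) : Fin (S.machine.reg i) :=
  (⟨L + Fin.val (n := t) τ, by have := Fin.isLt (n := t) τ; omega⟩ : Fin (L + t + 2))

/-- The private coins: the rows, and the random point of the sum-check protocol. -/
abbrev Coins : Type := (Fin t → Fin n) × (Fin L → S.R)

/-- The memory before the stream starts. -/
def initMem (ω : S.Coins) : S.machine.Mem where
  val i x := if h : x.val < L then ω.2 ⟨x.val, h⟩ i else (0 : S.machine.K i)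
  index := ω.1
  pos := 0

/-- The memory after the stream has been read. -/
def finalMem (σ : Fin n → Fin m) (ω : S.Coins) : S.machine.Mem :=
  (List.ofFn σ).foldl S.machine.update (S.initMem ω)

/-- The random point of the sum-check protocol in the memory. -/
def point (μ : S.machine.Mem) (j : Fin L) : S.R := fun i => μ.val i (S.pointReg i j)

/-- The random rows in the memory. -/
def rows (μ : S.machine.Mem) : Fin t → Fin n := μ.index

/-- The polynomial whose sum is computed in the field `K i`. -/
def poly (σ : Fin n → Fin m) (α : Fin t → Fin n) (i : Fin L) : (Fin L → S.K i) → S.K i :=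
  Sketch.occurs L (S.φ i) (S.G i) σ α

lemma coordDegreeLE_poly (σ : Fin n → Fin m) (α : Fin t → Fin n) (i : Fin L) :
    CoordDegreeLE S.D (S.poly σ α i) :=
  (Sketch.coordDegreeLE_occurs α).mono (S.degree_le i)

/-- The value of the polynomials at the random point, computed from the sketches. -/
def final (μ : S.machine.Mem) : S.R := fun i =>
  1 - ∏ τ, (1 - (show S.K i from μ.val i (S.sketchReg i τ)) ^ (S.p i - 1))

lemma separated : UpdateMachine.Separated (M := S.machine) S.pointReg S.sketchReg
    (fun _ => (⟨L + t, by omega⟩ : Fin (L + t + 2)))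
    (fun _ => (⟨L + t + 1, by omega⟩ : Fin (L + t + 2))) where
  pw i h := by simpa using Fin.ext_iff.mp h
  sp i j h := by
    have := Fin.ext_iff.mp h
    simp only [pointReg] at this
    omega
  sw i j h := by
    have := Fin.ext_iff.mp h
    simp only [pointReg] at this
    omega
  yp i τ h := by
    have := Fin.ext_iff.mp h
    have := Fin.isLt (n := t) τ
    simp only [sketchReg] at *
    omega
  yw i τ h := by
    have := Fin.ext_iff.mp h
    have := Fin.isLt (n := t) τ
    simp only [sketchReg] at *
    omega
  sy i j τ h := by
    have := Fin.ext_iff.mp h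
    simp only [sketchReg, pointReg] at *
    omega
  inj i τ τ' h := by
    have := Fin.ext_iff.mp h
    simp only [sketchReg] at this
    exact Fin.ext (by omega)

lemma point_initMem (ω : S.Coins) : S.point (S.initMem ω) = ω.2 := by
  funext j i
  exact dif_pos j.isLt

lemma finalMem_spec (σ : Fin n → Fin m) (ω : S.Coins) :
    S.rows (S.finalMem σ ω) = ω.1 ∧ S.point (S.finalMem σ ω) = ω.2 ∧
      S.final (S.finalMem σ ω) = fun i => S.poly σ ω.1 i fun j => ω.2 j i := by
  obtain ⟨h1, h2, h3⟩ := UpdateMachine.foldl_update_spec S.separated rfl σ (S.initMem ω) rfl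
  have hpt : ∀ i j, (S.initMem ω).val i (S.pointReg i j) = ω.2 j i :=
    fun i j => congrFun (congrFun (S.point_initMem ω) j) i
  have h0 : ∀ i τ, (S.initMem ω).val i (S.sketchReg i τ) = 0 := fun i τ =>
    dif_neg (by simp [sketchReg])
  have hcongr : ∀ {F : Type} [Field F] (g : Fin n → F) (c : Fin n → Fin L → F) {a b : Fin L → F},
      a = b → ∑ k, g k * ∏ j, (c k j + a j) = ∑ k, g k * ∏ j, (c k j + b j) := by
    rintro F _ g c a _ rfl
    rfl
  have key : ∀ i τ, (S.finalMem σ ω).val i (S.sketchReg i τ) = ∑ k, S.machine.G i (ω.1 τ) k *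
      ∏ j : Fin L, (UpdateMachine.digitVal (S.machine.K i) (σ k) j +
        (S.initMem ω).val i (S.pointReg i j)) := by
    intro i τ
    rw [finalMem, h3, h0, zero_add]
    rfl
  refine ⟨h1, ?_, ?_⟩
  · funext j i
    exact (h2 i j).trans (hpt i j)
  · funext i
    simp only [final, poly, Sketch.occurs]
    refine congrArg (1 - ·) (Finset.prod_congr rfl fun τ _ =>
      congrArg (fun x : S.K i => 1 - x ^ (S.p i - 1)) ?_)
    exact (key i τ).trans (hcongr (F := S.K i) _ _ (funext (hpt i)))

/-- The bits sent by the verifier. -/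
def bit (μ : S.machine.Mem) (k : ℕ) : Bool :=
  if h : k < S.A then S.encRows (S.rows μ) ⟨k, h⟩
  else if h' : (k - S.A) / S.B < L then
    S.encElt (S.point μ ⟨(k - S.A) / S.B, h'⟩) ⟨(k - S.A) % S.B, Nat.mod_lt _ S.B_pos⟩
  else false

open Classical in
/-- The least number with the given residues. -/
noncomputable def result (ρ : S.R) : Option ℕ :=
  if h : ∃ v : ℕ, ∀ i, (v : S.K i) = ρ i then some (Nat.find h) else none

lemma _root_.UpdateMachine.Mem.toProd_injective {n : ℕ} {M : UpdateMachine n} :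
    Function.Injective fun μ : M.Mem => (μ.val, μ.index, μ.pos) := by
  rintro ⟨_, _, _⟩ ⟨_, _, _⟩ h
  simp_all

instance : Finite S.machine.Mem := by
  have : ∀ i, Finite (S.machine.K i) := S.machine.finite
  exact Finite.of_injective _ UpdateMachine.Mem.toProd_injective

/-- The ingredients of the verifier. -/
noncomputable def data : SumCheckData m L S.machine.Mem S.R where
  A := S.A
  B := S.B
  D := S.D
  B_pos := S.B_pos
  init := haveI : Nonempty (Fin n) := ⟨⟨0, S.n_pos⟩⟩; (PMF.uniformOfFintype S.Coins).map S.initMem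
  update := S.machine.update
  bit := S.bit
  decode := Function.invFun S.encElt
  point := S.point
  final := S.final
  result := S.result

/-- The verifier for the number of distinct elements. -/
noncomputable def verifier : SIPVerifier m L := S.data.verifier

open Classical in
/-- By the Chinese remainder theorem, a number that is at most `m` is the least one with its
residues. -/
lemma result_eq_some {ρ : S.R} {v : ℕ} (hv : v ≤ m) (h : ∀ i, ρ i = v) : S.result ρ = some v := by
  have hex : ∃ v : ℕ, ∀ i, (v : S.K i) = ρ i := ⟨v, fun i => (h i).symm⟩
  rw [result, dif_pos hex]
  congr 1
  set u := Nat.find hex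
  have huv : u ≤ v := Nat.find_min' hex fun i => (h i).symm
  have hdvd : ∏ i, S.p i ∣ v - u := by
    refine Finset.prod_dvd_of_isRelPrime (fun i _ j _ hij => ?_) fun i _ => ?_
    · exact Nat.coprime_iff_isRelPrime.mp
        ((Nat.coprime_primes (S.prime i).out (S.prime j).out).mpr (S.p_injective.ne hij))
    · have : CharP (S.K i) (S.p i) := charP_of_injective_ringHom (S.φ i).injective (S.p i)
      have hu : (u : S.K i) = (v : S.K i) := (Nat.find_spec hex i).trans (h i)
      exact (Nat.modEq_iff_dvd' huv).mp ((CharP.natCast_eq_natCast (S.K i) (S.p i)).mp hu)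
  have := Nat.eq_zero_of_dvd_of_lt hdvd (by have := S.lt_prod; omega)
  omega

/-- All elements of the stream are detected in all fields. -/
def Good (σ : Fin n → Fin m) (α : Fin t → Fin n) : Prop := ∀ i, Sketch.Good (S.G i) σ α

lemma distinctElements_le (σ : Fin n → Fin m) : distinctElements σ ≤ m :=
  (Finset.card_le_univ _).trans_eq (Fintype.card_fin m)

lemma bit_congr {μ μ' : S.machine.Mem} {j : Fin L} (hα : S.rows μ = S.rows μ')
    (hr : ∀ k < j, S.point μ k = S.point μ' k) {k : ℕ} (hk : k < S.A + j * S.B) :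
    S.bit μ k = S.bit μ' k := by
  unfold bit
  rw [hα]
  split_ifs with h h'
  · rfl
  · rw [hr]
    exact Fin.lt_def.mpr (Nat.div_lt_of_lt_mul (by rw [mul_comm]; omega))
  · rfl

lemma history_congr {μ μ' : S.machine.Mem} {j : Fin L} (hα : S.rows μ = S.rows μ')
    (hr : ∀ k < j, S.point μ k = S.point μ' k) : S.data.history μ j = S.data.history μ' j :=
  List.map_congr_left fun _ hk => S.bit_congr hα hr (List.mem_range.mp hk)

/-- The prover learns the rows, and the coordinates of the random point of earlier rounds. -/
lemma eq_of_history_eq {μ μ' : S.machine.Mem} {j : Fin L}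
    (h : S.data.history μ j = S.data.history μ' j) :
    S.rows μ = S.rows μ' ∧ ∀ k < j, S.point μ k = S.point μ' k := by
  have hbit : ∀ k < S.A + j * S.B, S.bit μ k = S.bit μ' k := fun k hk =>
    List.map_inj_left.mp h k (List.mem_range.mpr hk)
  constructor
  · refine S.encRows_injective (funext fun k => ?_)
    have := hbit k (by have := k.isLt; omega)
    simpa [bit] using this
  · intro k hk
    refine S.encElt_injective (funext fun b => ?_)
    have hlt : k * S.B + b.val < j * S.B := by
      have := Nat.mul_le_mul_right S.B (Nat.succ_le_of_lt (Fin.lt_def.mp hk))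
      have := b.isLt
      nlinarith
    have hdiv : (k.val * S.B + b.val) / S.B = k := by
      rw [mul_comm, Nat.mul_add_div S.B_pos, Nat.div_eq_of_lt b.isLt, Nat.add_zero]
    have hmod : (k.val * S.B + b.val) % S.B = b := by
      rw [mul_comm, Nat.mul_add_mod, Nat.mod_eq_of_lt b.isLt]
    have := hbit (S.A + (k * S.B + b)) (by omega)
    simpa [bit, hdiv, hmod] using this

end SketchSetup

/-! ### Correctness of the verifier -/

open Classical in
lemma PMF.toOuterMeasure_uniformOfFintype_le {Ω : Type*} [Fintype Ω] [Nonempty Ω] (E : Set Ω)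
    {k : ℕ} (hk : k ≠ 0) (h : k * (Finset.univ.filter (· ∈ E)).card ≤ Fintype.card Ω) :
    (PMF.uniformOfFintype Ω).toOuterMeasure E ≤ 1 / k := by
  rw [PMF.toOuterMeasure_uniformOfFintype_apply, Fintype.card_subtype]
  refine ENNReal.div_le_of_le_mul ?_
  rw [one_div, mul_comm, ← div_eq_mul_inv, ENNReal.le_div_iff_mul_le (by simp [hk]) (by simp)]
  rw [mul_comm]
  exact_mod_cast h

lemma Fintype.card_fiber_mul_le {ι : Type*} [Fintype ι] [DecidableEq ι] {K : ι → Type*}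
    [∀ i, Fintype (K i)] (i : ι) (a : K i) :
    Nat.card {x : ∀ i, K i // x i = a} * Fintype.card (K i) ≤ Fintype.card (∀ i, K i) := by
  classical
  rw [← Nat.card_eq_fintype_card (α := K i), ← Nat.card_eq_fintype_card (α := ∀ i, K i),
    ← Nat.card_prod]
  refine Nat.card_le_card_of_injective
    (fun c : {x : ∀ i, K i // x i = a} × K i => Function.update c.1.1 i c.2) ?_
  rintro ⟨⟨x, hx⟩, b⟩ ⟨⟨y, hy⟩, b'⟩ h
  have hb : b = b' := by simpa using congrFun h i
  refine Prod.ext (Subtype.ext (funext fun j => ?_)) hb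
  by_cases hj : j = i
  · subst hj
    exact hx.trans hy.symm
  · have := congrFun h j
    simpa [hj] using this

namespace SketchSetup

open Polynomial

variable {m n L t : ℕ} (S : SketchSetup m n L t)

/-- The index of the first round. -/
def firstRound : Fin L := ⟨0, S.L_pos⟩

/-- The polynomials over `K i` sent by the prover. -/
noncomputable def sent (σ : Fin n → Fin m) (P : S.verifier.Strategy) (ω : S.Coins) (j : Fin L)
    (i : Fin L) : (S.K i)[X] :=
  coeffPoly ((S.data.message P (S.finalMem σ ω) j).map fun c => c i)

lemma sent_eq (σ : Fin n → Fin m) (P : S.verifier.Strategy) (ω : S.Coins) (j i : Fin L) :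
    S.sent σ P ω j i = coeffPoly ((S.data.symbols
      (P j (S.data.history (S.finalMem σ ω) j))).map fun c => c i) := rfl

lemma natDegree_sent_le (σ : Fin n → Fin m) (P : S.verifier.Strategy) (ω : S.Coins) (j i : Fin L) :
    (S.sent σ P ω j i).natDegree ≤ S.D := by
  refine (natDegree_coeffPoly_le _).trans_eq ?_
  rw [List.length_map]
  exact congrArg (· - 1) (SumCheckData.length_symbols S.data _)

lemma sent_congr (σ : Fin n → Fin m) (P : S.verifier.Strategy) (α : Fin t → Fin n)
    (r r' : Fin L → S.R) (j : Fin L) (h : ∀ k < j, r k = r' k) (i : Fin L) :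
    S.sent σ P (α, r) j i = S.sent σ P (α, r') j i := by
  obtain ⟨h1, h2, -⟩ := S.finalMem_spec σ (α, r)
  obtain ⟨h1', h2', -⟩ := S.finalMem_spec σ (α, r')
  rw [sent_eq, sent_eq,
    S.history_congr (h1.trans h1'.symm) fun k hk => by rw [h2, h2']; exact h k hk]

lemma convinced_iff (σ : Fin n → Fin m) (P : S.verifier.Strategy) (ω : S.Coins) :
    S.data.Convinced (S.finalMem σ ω) (S.data.message P (S.finalMem σ ω)) ↔
      ∀ i, SumCheck.Accepts (S.poly σ ω.1 i) (fun j => S.sent σ P ω j i) fun j => ω.2 j i := by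
  obtain ⟨-, h2, h3⟩ := S.finalMem_spec σ ω
  have hpt : S.data.point (S.finalMem σ ω) = ω.2 := h2
  have hfin : S.data.final (S.finalMem σ ω) = fun i => S.poly σ ω.1 i fun j => ω.2 j i := h3
  simp only [SumCheckData.Convinced, SumCheck.Accepts, hpt, hfin, funext_iff, Pi.add_apply,
    horner_pi_apply, sent, Pi.zero_apply, Pi.neg_apply, Pi.one_apply]
  constructor
  · exact fun h i => ⟨fun k k' hk => h.1 k k' hk i, fun k hk => h.2 k hk i⟩
  · exact fun h => ⟨fun k k' hk i => (h i).1 k k' hk, fun k hk i => (h i).2 k hk⟩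

/-- The answer of the verifier for the coins `ω`. -/
noncomputable def answer (σ : Fin n → Fin m) (P : S.verifier.Strategy) (ω : S.Coins) : Option ℕ :=
  S.verifier.answer σ P (S.data.start (S.initMem ω))

open Classical in
lemma answer_eq (σ : Fin n → Fin m) (P : S.verifier.Strategy) (ω : S.Coins) :
    S.answer σ P ω = if ∀ i, SumCheck.Accepts (S.poly σ ω.1 i) (fun j => S.sent σ P ω j i)
      (fun j => ω.2 j i) then S.result (fun i => (S.sent σ P ω S.firstRound i).eval 0 +
        (S.sent σ P ω S.firstRound i).eval (-1)) else none := by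
  refine (SumCheckData.answer_start σ P (S.initMem ω) S.firstRound rfl).trans ?_
  refine if_congr (S.convinced_iff σ P ω) (congrArg S.result ?_) rfl
  funext i
  rw [Pi.add_apply]
  erw [horner_pi_apply, horner_pi_apply]
  rfl

lemma answerDist_eq (σ : Fin n → Fin m) (P : S.verifier.Strategy) :
    S.verifier.answerDist σ P = haveI : Nonempty (Fin n) := ⟨⟨0, S.n_pos⟩⟩
      (PMF.uniformOfFintype S.Coins).map (S.answer σ P) := by
  have : Nonempty (Fin n) := ⟨⟨0, S.n_pos⟩⟩
  refine (congrArg (PMF.map (S.verifier.answer σ P)) (PMF.map_comp S.initMem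
    (PMF.uniformOfFintype S.Coins) S.data.start)).trans ?_
  exact PMF.map_comp (S.data.start ∘ S.initMem) (PMF.uniformOfFintype S.Coins)
    (S.verifier.answer σ P)

lemma partialSum_poly {σ : Fin n → Fin m} {α : Fin t → Fin n} (hα : S.Good σ α) (i : Fin L)
    (r : Fin L → S.K i) : SumCheck.partialSum (S.poly σ α i) 0 r = (distinctElements σ : S.K i) :=
  Sketch.partialSum_occurs S.le_two_pow (hα i) r

open Classical in
lemma prob_not_good_le [Nonempty (Fin n)] (σ : Fin n → Fin m) :
    (PMF.uniformOfFintype S.Coins).toOuterMeasure {ω | ¬ S.Good σ ω.1} ≤ 1 / 6 := by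
  have hm : 0 < m := (σ ⟨0, S.n_pos⟩).pos
  have hα : 6 * (Finset.univ.filter fun α : Fin t → Fin n => ¬ S.Good σ α).card ≤ n ^ t := by
    have hsub : (Finset.univ.filter fun α : Fin t → Fin n => ¬ S.Good σ α) ⊆
        Finset.univ.biUnion fun i : Fin L =>
          Finset.univ.filter fun α : Fin t → Fin n => ¬ Sketch.Good (S.G i) σ α := by
      intro α
      simp [Good]
    have h1 : (Finset.univ.filter fun α : Fin t → Fin n => ¬ S.Good σ α).card * 2 ^ t ≤
        L * (m * n ^ t) :=
      calc _ ≤ (∑ i : Fin L, (Finset.univ.filter fun α : Fin t → Fin n =>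
              ¬ Sketch.Good (S.G i) σ α).card) * 2 ^ t :=
            Nat.mul_le_mul_right _ ((Finset.card_le_card hsub).trans Finset.card_biUnion_le)
        _ = ∑ i : Fin L, (Finset.univ.filter fun α : Fin t → Fin n =>
              ¬ Sketch.Good (S.G i) σ α).card * 2 ^ t := Finset.sum_mul _ _ _
        _ ≤ ∑ _i : Fin L, m * n ^ t :=
            Finset.sum_le_sum fun i _ => Sketch.card_not_good_mul_le (S.row_sum i) σ t
        _ = L * (m * n ^ t) := by simp
    refine Nat.le_of_mul_le_mul_left ?_ (Nat.mul_pos S.L_pos hm)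
    have h2 := Nat.mul_le_mul_left
      (Finset.univ.filter fun α : Fin t → Fin n => ¬ S.Good σ α).card S.rows_large
    calc _ = (Finset.univ.filter fun α : Fin t → Fin n => ¬ S.Good σ α).card * (6 * (L * m)) := by
          ring
      _ ≤ _ := h2
      _ ≤ _ := h1
      _ = _ := by ring
  refine (PMF.toOuterMeasure_uniformOfFintype_le _ (k := 6) (by norm_num) ?_).trans_eq (by simp)
  simp only [Set.mem_ofPred_eq]
  rw [Finset.card_filter, Fintype.sum_prod_type_right]
  simp only [← Finset.card_filter, Finset.sum_const, smul_eq_mul, Finset.card_univ,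
    Fintype.card_prod]
  rw [mul_left_comm, mul_comm]
  exact Nat.mul_le_mul_right _ (hα.trans_eq (by simp))

open Classical in
/-- If the rows detect all elements, then a wrong answer requires that the prover cheats
successfully in the sum-check protocol over one of the fields. -/
lemma card_wrong_le (σ : Fin n → Fin m) (P : S.verifier.Strategy) {α : Fin t → Fin n}
    (hα : S.Good σ α) : 6 * (Finset.univ.filter fun r : Fin L → S.R =>
      S.answer σ P (α, r) ≠ none ∧ S.answer σ P (α, r) ≠ some (distinctElements σ)).card ≤
      Fintype.card (Fin L → S.R) := by
  let W : Fin L → Finset (Fin L → S.R) := fun i => Finset.univ.filter fun r =>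
    SumCheck.Accepts (S.poly σ α i) (fun j => S.sent σ P (α, r) j i) (fun j => r j i) ∧
      (S.sent σ P (α, r) S.firstRound i).eval 0 + (S.sent σ P (α, r) S.firstRound i).eval (-1) ≠
        (distinctElements σ : S.K i)
  have hsub : (Finset.univ.filter fun r : Fin L → S.R => S.answer σ P (α, r) ≠ none ∧
      S.answer σ P (α, r) ≠ some (distinctElements σ)) ⊆ Finset.univ.biUnion W := by
    intro r hr
    obtain ⟨h1, h2⟩ := (Finset.mem_filter.mp hr).2
    rw [answer_eq] at h1 h2
    have hacc : ∀ i, SumCheck.Accepts (S.poly σ α i) (fun j => S.sent σ P (α, r) j i)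
        fun j => r j i := by
      by_contra hcon
      exact h1 (if_neg hcon)
    rw [if_pos hacc] at h2
    have hex : ∃ i, (S.sent σ P (α, r) S.firstRound i).eval 0 +
        (S.sent σ P (α, r) S.firstRound i).eval (-1) ≠ (distinctElements σ : S.K i) := by
      by_contra! hcon
      exact h2 (S.result_eq_some (distinctElements_le σ) hcon)
    obtain ⟨i, hi⟩ := hex
    exact Finset.mem_biUnion.mpr
      ⟨i, Finset.mem_univ i, Finset.mem_filter.mpr ⟨Finset.mem_univ r, hacc i, hi⟩⟩
  have hW : ∀ i, 6 * L * (W i).card ≤ Fintype.card (Fin L → S.R) := by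
    intro i
    have h := SumCheck.card_accepts_mul_card_le (Ω := S.R) (K := S.K i) (fun x => x i)
      (Fintype.card_fiber_mul_le i) (S.coordDegreeLE_poly σ α i) S.firstRound rfl
      (distinctElements σ : S.K i) (S.partialSum_poly hα i)
      (fun r j => S.sent σ P (α, r) j i) (fun r j => S.natDegree_sent_le σ P (α, r) j i)
      (fun r r' j hr => S.sent_congr σ P α r r' j hr i)
    rw [Nat.card_eq_fintype_card, Fintype.card_subtype] at h
    refine Nat.le_of_mul_le_mul_left ?_ (Nat.mul_pos S.L_pos S.D_pos)
    calc _ = (W i).card * (6 * L * (L * S.D)) := by ring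
      _ ≤ (W i).card * Fintype.card (S.K i) := Nat.mul_le_mul_left _ (S.le_card i)
      _ ≤ _ := h
  refine Nat.le_of_mul_le_mul_left ?_ S.L_pos
  calc _ ≤ L * (6 * ∑ i, (W i).card) := Nat.mul_le_mul_left _ (Nat.mul_le_mul_left _
        ((Finset.card_le_card hsub).trans Finset.card_biUnion_le))
    _ = ∑ i, 6 * L * (W i).card := by rw [← Finset.mul_sum]; ring
    _ ≤ ∑ _i : Fin L, Fintype.card (Fin L → S.R) := Finset.sum_le_sum fun i _ => hW i
    _ = _ := by simp

open Classical in
theorem sound (σ : Fin n → Fin m) (P : S.verifier.Strategy) :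
    (S.verifier.answerDist σ P).toOuterMeasure
      {o | o ≠ none ∧ o ≠ some (distinctElements σ)} ≤ 1 / 3 := by
  have : Nonempty (Fin n) := ⟨⟨0, S.n_pos⟩⟩
  rw [answerDist_eq, PMF.toOuterMeasure_map_apply]
  have hsub : S.answer σ P ⁻¹' {o | o ≠ none ∧ o ≠ some (distinctElements σ)} ⊆
      {ω | ¬ S.Good σ ω.1} ∪ {ω | S.Good σ ω.1 ∧ S.answer σ P ω ≠ none ∧
        S.answer σ P ω ≠ some (distinctElements σ)} := by
    intro ω hω
    by_cases h : S.Good σ ω.1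
    · exact Or.inr ⟨h, hω⟩
    · exact Or.inl h
  have h2 : (PMF.uniformOfFintype S.Coins).toOuterMeasure {ω | S.Good σ ω.1 ∧
      S.answer σ P ω ≠ none ∧ S.answer σ P ω ≠ some (distinctElements σ)} ≤ 1 / 6 := by
    refine (PMF.toOuterMeasure_uniformOfFintype_le _ (k := 6) (by norm_num) ?_).trans_eq (by simp)
    simp only [Set.mem_ofPred_eq]
    rw [Finset.card_filter, Fintype.sum_prod_type, Finset.mul_sum, Fintype.card_prod]
    refine (Finset.sum_le_card_nsmul _ _ (Fintype.card (Fin L → S.R)) fun α _ => ?_).trans_eq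
      (by simp)
    rw [← Finset.card_filter]
    by_cases hα : S.Good σ α
    · simpa [hα] using S.card_wrong_le σ P hα
    · simp [hα]
  calc _ ≤ (PMF.uniformOfFintype S.Coins).toOuterMeasure _ :=
        MeasureTheory.OuterMeasure.mono _ hsub
    _ ≤ _ := MeasureTheory.measure_union_le _ _
    _ ≤ 1 / 6 + 1 / 6 := add_le_add (S.prob_not_good_le σ) h2
    _ = 1 / 3 := by
        rw [ENNReal.div_add_div_same, one_add_one_eq_two]
        rw [ENNReal.div_eq_div_iff (by norm_num) (by norm_num) (by norm_num) (by norm_num)]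
        norm_num

/-- Any polynomials of degree at most `D` can be sent by the prover. -/
lemma exists_message (q : ∀ i, (S.K i)[X]) : ∃ w : Fin ((S.D + 1) * S.B) → Bool,
    (∀ i, (q i).natDegree ≤ S.D) → ∀ i,
      coeffPoly ((S.data.symbols w).map fun c => c i) = q i := by
  by_cases hq : ∀ i, (q i).natDegree ≤ S.D
  swap
  · exact ⟨fun _ => false, fun h => absurd h hq⟩
  choose cs hlen hcs using fun i => exists_coeffPoly_eq S.D (q i) (hq i)
  let c : Fin (S.D + 1) → S.R := fun k i => (cs i)[k]'(by rw [hlen]; exact k.isLt)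
  refine ⟨fun x => S.encElt (c ⟨x / S.B, Nat.div_lt_of_lt_mul (x.isLt.trans_eq (mul_comm _ _))⟩)
    ⟨x % S.B, Nat.mod_lt _ S.B_pos⟩, fun _ i => ?_⟩
  have hsym : S.data.symbols (fun x : Fin ((S.D + 1) * S.B) =>
      S.encElt (c ⟨x / S.B, Nat.div_lt_of_lt_mul (x.isLt.trans_eq (mul_comm _ _))⟩)
        ⟨x % S.B, Nat.mod_lt _ S.B_pos⟩) = List.ofFn c := by
    refine congrArg List.ofFn (funext fun k => ?_)
    refine (congrArg (Function.invFun S.encElt) (funext fun b => ?_)).trans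
      (Function.leftInverse_invFun S.encElt_injective (c k))
    have hb : b.val < S.B := b.isLt
    have hdiv : (k.val * S.B + b.val) / S.B = k := by
      rw [mul_comm, Nat.mul_add_div S.B_pos, Nat.div_eq_of_lt hb, Nat.add_zero]
    have hmod : (k.val * S.B + b.val) % S.B = b := by
      rw [mul_comm, Nat.mul_add_mod, Nat.mod_eq_of_lt hb]
    exact congrArg₂ S.encElt (congrArg c (Fin.ext hdiv)) (Fin.ext hmod)
  rw [hsym, ← hcs i]
  congr 1
  refine List.ext_getElem (by simp [hlen]) fun k h1 h2 => ?_
  simp only [List.getElem_map, List.getElem_ofFn, c]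
  rfl

/-- The polynomials the honest prover sends in round `j`. -/
noncomputable def honest (σ : Fin n → Fin m) (ω : S.Coins) (j i : Fin L) : (S.K i)[X] :=
  SumCheck.honestPoly (S.poly σ ω.1 i) S.D j fun k => ω.2 k i

open Classical in
/-- The honest prover: he picks some coins that are consistent with what he has received, and
sends the polynomials that belong to these coins. -/
noncomputable def honestProver (σ : Fin n → Fin m) : S.verifier.Strategy := fun j h =>
  if hω : ∃ ω : S.Coins, S.data.history (S.finalMem σ ω) j = h then
    (S.exists_message (S.honest σ hω.choose j)).choose
  else fun _ => false

lemma sent_honestProver (σ : Fin n → Fin m) (ω : S.Coins) (j i : Fin L) :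
    S.sent σ (S.honestProver σ) ω j i = S.honest σ ω j i := by
  have hex : ∃ ω' : S.Coins, S.data.history (S.finalMem σ ω') j =
      S.data.history (S.finalMem σ ω) j := ⟨ω, rfl⟩
  have hmsg : S.honestProver σ j (S.data.history (S.finalMem σ ω) j) =
      (S.exists_message (S.honest σ hex.choose j)).choose := dif_pos hex
  obtain ⟨h1, h2⟩ := S.eq_of_history_eq hex.choose_spec
  obtain ⟨h3, h4, -⟩ := S.finalMem_spec σ ω
  obtain ⟨h3', h4', -⟩ := S.finalMem_spec σ hex.choose
  rw [h3, h3'] at h1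
  rw [h4, h4'] at h2
  rw [sent_eq, hmsg,
    (S.exists_message (S.honest σ hex.choose j)).choose_spec
      fun i => SumCheck.natDegree_honestPoly_le _ _ _ _]
  rw [honest, honest, h1]
  exact SumCheck.honestPoly_congr fun k hk => by rw [h2 k hk]

lemma answer_honestProver (σ : Fin n → Fin m) (ω : S.Coins) (hω : S.Good σ ω.1) :
    S.answer σ (S.honestProver σ) ω = some (distinctElements σ) := by
  rw [answer_eq, if_pos]
  · refine S.result_eq_some (distinctElements_le σ) fun i => ?_
    rw [sent_honestProver, honest,
      SumCheck.eval_honestPoly_zero_add (S.coordDegreeLE_poly σ ω.1 i)]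
    exact S.partialSum_poly hω i _
  · intro i
    simp only [sent_honestProver]
    exact SumCheck.accepts_honestPoly (S.coordDegreeLE_poly σ ω.1 i) _

theorem complete (σ : Fin n → Fin m) : 1 - 1 / 6 ≤
    S.verifier.answerDist σ (S.honestProver σ) (some (distinctElements σ)) := by
  have : Nonempty (Fin n) := ⟨⟨0, S.n_pos⟩⟩
  rw [← PMF.toOuterMeasure_apply_singleton, answerDist_eq, PMF.toOuterMeasure_map_apply,
    tsub_le_iff_right]
  set E := S.answer σ (S.honestProver σ) ⁻¹' {some (distinctElements σ)}
  have hcover : (Set.univ : Set S.Coins) ⊆ E ∪ {ω | ¬ S.Good σ ω.1} := by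
    intro ω _
    by_cases h : S.Good σ ω.1
    · exact Or.inl (S.answer_honestProver σ ω h)
    · exact Or.inr h
  calc (1 : ENNReal) = (PMF.uniformOfFintype S.Coins).toOuterMeasure Set.univ :=
        ((PMF.toOuterMeasure_apply_eq_one_iff _ _).mpr (Set.subset_univ _)).symm
    _ ≤ (PMF.uniformOfFintype S.Coins).toOuterMeasure _ :=
        MeasureTheory.OuterMeasure.mono _ hcover
    _ ≤ _ := MeasureTheory.measure_union_le _ _
    _ ≤ _ := add_le_add le_rfl (S.prob_not_good_le σ)

theorem computes : S.verifier.Computes (fun σ : Fin n → Fin m => distinctElements σ)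
    (1 / 6) (1 / 3) :=
  ⟨⟨S.honestProver, S.complete⟩, S.sound⟩

end SketchSetup

/-! ### Resources -/

namespace SketchSetup

variable {m n L t : ℕ} (S : SketchSetup m n L t)

lemma communication_le : S.verifier.communication ≤ S.A + L * (S.B * (S.D + 2)) := by
  have hv : ∀ j, S.verifier.vlen j ≤ (if j = S.firstRound then S.A else 0) + S.B := by
    intro j
    change (if j.val = 0 then S.A else S.B) ≤ _
    by_cases hj : j.val = 0
    · rw [if_pos hj, if_pos (Fin.ext hj)]
      omega
    · rw [if_neg hj]
      omega
  have hp : ∀ j, S.verifier.plen j = (S.D + 1) * S.B := fun _ => rfl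
  rw [SIPVerifier.communication]
  calc _ ≤ ∑ j : Fin L, ((if j = S.firstRound then S.A else 0) + S.B + (S.D + 1) * S.B) :=
        Finset.sum_le_sum fun j _ => Nat.add_le_add (hv j) (hp j).le
    _ = _ := by
        simp [Finset.sum_add_distrib]
        ring

lemma card_R_le : Nat.card S.R ≤ 2 ^ S.B := by
  simpa using Nat.card_le_card_of_injective _ S.encElt_injective

lemma card_rows_le : n ^ t ≤ 2 ^ S.A := by
  simpa using Nat.card_le_card_of_injective _ S.encRows_injective

lemma card_mem_le :
    Nat.card S.machine.Mem ≤ 2 ^ (S.B * (L + t + 2) + S.A + (Nat.clog 2 n + 1)) := by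
  have : ∀ i, Finite (S.machine.K i) := S.machine.finite
  have hinj := Nat.card_le_card_of_injective _
    (UpdateMachine.Mem.toProd_injective (M := S.machine))
  have hval : Nat.card (∀ i : Fin S.machine.f, Fin (S.machine.reg i) → S.machine.K i) ≤
      2 ^ (S.B * (L + t + 2)) := by
    have h : Nat.card (∀ i : Fin S.machine.f, Fin (S.machine.reg i) → S.machine.K i) =
        Nat.card S.R ^ (L + t + 2) := by
      change Nat.card (∀ i : Fin L, Fin (L + t + 2) → S.K i) = _
      simp only [Nat.card_pi, Finset.prod_const, Finset.card_univ, Fintype.card_fin]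
      rw [Finset.prod_pow]
    rw [h, pow_mul]
    exact Nat.pow_le_pow_left S.card_R_le _
  have hidx : Nat.card (Fin S.machine.idx → Fin S.machine.rows) ≤ 2 ^ S.A := by
    change Nat.card (Fin t → Fin n) ≤ _
    simpa using S.card_rows_le
  have hpos : Nat.card (Fin (n + 1)) ≤ 2 ^ (Nat.clog 2 n + 1) := by
    have := Nat.le_pow_clog (b := 2) (by norm_num) n
    have := S.n_pos
    rw [Nat.card_fin, pow_succ]
    omega
  rw [Nat.card_prod, Nat.card_prod] at hinj
  refine hinj.trans ?_
  rw [pow_add, pow_add, mul_assoc]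
  exact Nat.mul_le_mul hval (Nat.mul_le_mul hidx hpos)

lemma D_le : S.D + 1 ≤ 2 ^ (S.B + 1) := by
  have h := S.le_card S.firstRound
  have h1 : Fintype.card (S.K S.firstRound) ≤ Nat.card S.R := by
    rw [Nat.card_eq_fintype_card, ← one_mul (Fintype.card (S.K S.firstRound))]
    have hpos : 0 < Nat.card {x : S.R // x S.firstRound = 0} := by
      have : Nonempty {x : S.R // x S.firstRound = 0} := ⟨⟨0, rfl⟩⟩
      exact Nat.card_pos
    exact (Nat.mul_le_mul_right _ hpos).trans (Fintype.card_fiber_mul_le S.firstRound 0)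
  have h2 : S.D ≤ 6 * L * (L * S.D) := by
    have := S.L_pos
    nlinarith [Nat.mul_pos S.L_pos S.L_pos, Nat.zero_le S.D, Nat.mul_le_mul_right S.D
      (Nat.mul_pos S.L_pos S.L_pos)]
  have h3 := S.card_R_le
  have h4 : 1 ≤ 2 ^ S.B := Nat.one_le_two_pow
  rw [pow_succ]
  omega

lemma space_le : S.verifier.space ≤
    S.B * (2 * L + t + 9) + 2 * S.A + Nat.clog 2 n + L + 3 := by
  refine Nat.clog_le_of_le_pow ?_
  have hinj := Nat.card_le_card_of_injective _
    (SumCheckData.State.toProd_injective (Mem := S.machine.Mem) (R := S.R) (d := L)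
      (T := S.data.T) (B := S.B) (D := S.D))
  refine hinj.trans ?_
  simp only [Nat.card_prod, Nat.card_fin, Nat.card_fun, Nat.card_eq_fintype_card (α := Bool),
    Fintype.card_bool]
  have hT : S.data.T + 1 ≤ 2 ^ (S.A + L * S.B) := Nat.lt_two_pow_self
  have hB : S.B ≤ 2 ^ S.B := Nat.lt_two_pow_self.le
  have hL : L + 1 ≤ 2 ^ L := Nat.lt_two_pow_self
  have hR := S.card_R_le
  calc _ ≤ 2 ^ (S.B * (L + t + 2) + S.A + (Nat.clog 2 n + 1)) * (2 ^ (S.A + L * S.B) *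
        (2 ^ S.B * (2 ^ S.B * (2 ^ S.B * (2 ^ S.B * (2 ^ (S.B + 1) * (2 ^ L * (2 ^ S.B *
          (2 ^ S.B * 2 ^ 1))))))))) := by
        refine Nat.mul_le_mul S.card_mem_le ?_
        refine Nat.mul_le_mul hT (Nat.mul_le_mul hB (Nat.mul_le_mul le_rfl (Nat.mul_le_mul hR
          (Nat.mul_le_mul hR (Nat.mul_le_mul S.D_le (Nat.mul_le_mul hL (Nat.mul_le_mul hR
            (Nat.mul_le_mul hR le_rfl))))))))
    _ = _ := by
        simp only [← pow_add]
        congr 1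
        ring

lemma updateTimeLE {w T : ℕ} (hw : ∀ i, Fintype.card (S.K i) ≤ w)
    (hT : L * (1 + 3 * L + 3 * t) + 1 ≤ T) : S.verifier.UpdateTimeLE n w T := by
  refine ⟨S.machine, fun i : Fin L => (Nat.card_eq_fintype_card (α := S.K i)).trans_le (hw i), ?_,
    S.data.start, ?_, ?_, fun _ _ => rfl⟩
  · exact (congrArg (· + 1) (UpdateMachine.length_sketchProg _ _ _ _)).trans_le hT
  · intro μ μ' h
    exact congrArg SumCheckData.State.mem h
  · intro s hs
    have : Nonempty (Fin n) := ⟨⟨0, S.n_pos⟩⟩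
    obtain ⟨μ, hμ, rfl⟩ := (PMF.mem_support_map_iff _ _ _).mp hs
    obtain ⟨ω, -, rfl⟩ := (PMF.mem_support_map_iff _ _ _).mp hμ
    exact ⟨S.initMem ω, rfl, rfl⟩

end SketchSetup

/-! ### Choice of the parameters -/

/-- The primes are chosen between `L + 32` and `4 (2 L + 31) u`, where `u` is about `log L`; the
fields have degree `8` over their prime fields, which makes them large enough for the sum-check
protocol. -/
theorem exists_sketchSetup {m n L u : ℕ} (hn : 1 ≤ n) (hL : 0 < L) (hmL : m ≤ 2 ^ L)
    (hu : 2 * L + 31 ≤ 2 ^ u) (huL : u ≤ 2 * L + 31) :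
    ∃ S : SketchSetup m n L (2 * L + 3), S.A = (2 * L + 3) * Nat.clog 2 n ∧
      S.B = L * (16 * u + 16) ∧ S.D = (2 * L + 3) * (4 * (2 * L + 31) * u) ∧
      ∀ i, Fintype.card (S.K i) ≤ (4 * (2 * L + 31) * u) ^ 8 := by
  have hu2 : 2 ≤ u := by
    by_contra! h
    have := hu.trans (Nat.pow_le_pow_right (by norm_num) (Nat.lt_succ_iff.mp h))
    omega
  obtain ⟨X, hX⟩ : ∃ X, X = 4 * (2 * L + 31) * u := ⟨_, rfl⟩
  rw [← hX]
  have hX0 : 0 < X := by rw [hX]; positivity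
  let p : Fin L → ℕ := fun i => Nat.nth Nat.Prime (L + 30 + i)
  have hprime : ∀ i, Fact (p i).Prime := fun i => ⟨Nat.prime_nth_prime _⟩
  have hpX : ∀ i, p i ≤ X := fun i => hX ▸ nth_prime_le (k := 2 * L + 30) (by omega) hu2 (by omega)
  have hpL : ∀ i, L + 32 ≤ p i := fun i => by
    have := Nat.add_two_le_nth_prime (L + 30 + i)
    simp only [p]
    omega
  have hpinj : Function.Injective p := fun i j h => by
    have := Nat.nth_injective Nat.infinite_setOfPred_prime h
    exact Fin.ext (by omega)
  choose G hG using fun i => exists_matrix_sum_ne_zero (p i) (by have := hpL i; omega) n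
  let K : Fin L → Type := fun i => GaloisField (p i) 8
  let hfield : ∀ i, Field (K i) := fun i => (inferInstance : Field (GaloisField (p i) 8))
  have hfinite : ∀ i, Finite (K i) := fun i => inferInstanceAs (Finite (GaloisField (p i) 8))
  let hfintype : ∀ i, Fintype (K i) := fun i => Fintype.ofFinite _
  have hcard : ∀ i, Fintype.card (K i) = p i ^ 8 := fun i => by
    rw [← Nat.card_eq_fintype_card]
    exact GaloisField.card (p i) 8 (by norm_num)
  have hX2 : X ^ 8 ≤ 2 ^ (16 * u + 16) := by
    have h1 : u ≤ 2 ^ u := Nat.lt_two_pow_self.le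
    calc X ^ 8 ≤ (4 * 2 ^ u * 2 ^ u) ^ 8 :=
          hX ▸ Nat.pow_le_pow_left (Nat.mul_le_mul (Nat.mul_le_mul_left _ hu) h1) 8
      _ = 2 ^ (16 * u + 16) := by
          rw [show 4 * 2 ^ u * 2 ^ u = 2 ^ (2 * u + 2) by ring, ← pow_mul]
          congr 1
          ring
  have hrows : Nonempty ((Fin (2 * L + 3) → Fin n) ↪
      (Fin ((2 * L + 3) * Nat.clog 2 n) → Bool)) := by
    refine Function.Embedding.nonempty_of_card_le ?_
    simp only [Fintype.card_fun, Fintype.card_fin, Fintype.card_bool]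
    rw [mul_comm (2 * L + 3) (Nat.clog 2 n), pow_mul]
    exact Nat.pow_le_pow_left (Nat.le_pow_clog (b := 2) (by norm_num) n) _
  have helt : Nonempty ((∀ i, K i) ↪ (Fin (L * (16 * u + 16)) → Bool)) := by
    refine Function.Embedding.nonempty_of_card_le ?_
    simp only [Fintype.card_fun, Fintype.card_fin, Fintype.card_bool, Fintype.card_pi, hcard]
    calc ∏ i, p i ^ 8 ≤ ∏ _i : Fin L, 2 ^ (16 * u + 16) := Finset.prod_le_prod' fun i _ =>
          (Nat.pow_le_pow_left (hpX i) 8).trans hX2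
      _ = 2 ^ (L * (16 * u + 16)) := by
          rw [Finset.prod_const, Finset.card_univ, Fintype.card_fin, ← pow_mul, mul_comm]
  obtain ⟨eα⟩ := hrows
  obtain ⟨eR⟩ := helt
  refine ⟨
    { p := p
      K := K
      prime := hprime
      field := hfield
      fintype := hfintype
      φ := fun i => algebraMap (ZMod (p i)) (GaloisField (p i) 8)
      G := G
      A := (2 * L + 3) * Nat.clog 2 n
      B := L * (16 * u + 16)
      D := (2 * L + 3) * X
      encRows := eα
      encElt := eR
      n_pos := hn
      L_pos := hL
      B_pos := by positivity
      D_pos := by positivity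
      le_two_pow := hmL
      row_sum := hG
      encRows_injective := eα.injective
      encElt_injective := eR.injective
      p_injective := hpinj
      lt_prod := ?_
      degree_le := fun i => Nat.mul_le_mul_left _ ((Nat.sub_le _ _).trans (hpX i))
      le_card := fun i => ?_
      rows_large := ?_ }, rfl, rfl, rfl, fun i => ?_⟩
  · refine hmL.trans_lt ?_
    have : ∏ _i : Fin L, 2 < ∏ i, p i := by
      refine Finset.prod_lt_prod_of_nonempty (fun _ _ => by norm_num)
        (fun i _ => by have := hpL i; omega) ⟨⟨0, hL⟩, Finset.mem_univ _⟩
    simpa using this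
  · refine le_trans ?_ (hcard i).ge
    have hp := hpL i
    set q := p i
    -- all factors of the bound are at most `2 q`, since the primes start beyond `L`
    have h1 : 6 * L * (L * ((2 * L + 3) * X)) ≤
        6 * q * (q * ((2 * q) * (4 * (2 * q) * (2 * q)))) := by
      rw [hX]
      gcongr <;> omega
    calc _ ≤ _ := h1
      _ = 192 * q ^ 5 := by ring
      _ ≤ q ^ 3 * q ^ 5 := Nat.mul_le_mul_right _ (by
          calc 192 ≤ 32 ^ 3 := by norm_num
            _ ≤ q ^ 3 := Nat.pow_le_pow_left (by omega) 3)
      _ = q ^ 8 := by ring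
  · have h1 : L ≤ 2 ^ L := Nat.lt_two_pow_self.le
    calc 6 * (L * m) ≤ 8 * (2 ^ L * 2 ^ L) :=
          Nat.mul_le_mul (by norm_num) (Nat.mul_le_mul h1 hmL)
      _ = 2 ^ (2 * L + 3) := by ring
  · exact (hcard i).trans_le (Nat.pow_le_pow_left (hpX i) 8)

/-! ### The bounds -/

/-- The logarithmic quantities of the bounds, when the universe has at least three elements. -/
lemma log_bounds {m n : ℕ} (hm : 3 ≤ m) (hn : 1 ≤ n) :
    let ℓ := Real.logb 2 m
    let lam := Real.logb 2 ℓ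
    1 ≤ ℓ ∧ 1 ≤ 2 * lam ∧ 0 ≤ Real.logb 2 n ∧ (Nat.clog 2 m : ℝ) ≤ 2 * ℓ ∧
      (Nat.clog 2 n : ℝ) ≤ Real.logb 2 n + 1 ∧
      (Nat.clog 2 (2 * Nat.clog 2 m + 31) : ℝ) ≤ 17 * lam := by
  intro ℓ lam
  have hclog : ∀ k : ℕ, 1 ≤ k → (Nat.clog 2 k : ℝ) ≤ Real.logb 2 k + 1 := by
    intro k hk
    have h0 : 0 ≤ Real.logb 2 k := Real.logb_nonneg (by norm_num) (by exact_mod_cast hk)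
    have h := (Nat.ceil_lt_add_one h0).le
    have h2 := Real.natCeil_logb_natCast 2 k
    rw [Nat.cast_ofNat] at h2
    rwa [h2] at h
  have hℓ : 3 / 2 ≤ ℓ := by
    rw [Real.le_logb_iff_rpow_le (by norm_num) (by positivity)]
    have h3 : (3 : ℝ) ≤ m := by exact_mod_cast hm
    refine le_trans ?_ h3
    have : ((2 : ℝ) ^ (3 / 2 : ℝ)) ^ 2 = 8 := by
      rw [← Real.rpow_natCast, ← Real.rpow_mul (by norm_num)]
      norm_num
    nlinarith [Real.rpow_nonneg (show (0 : ℝ) ≤ 2 by norm_num) (3 / 2 : ℝ)]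
  have hlam : 1 / 2 ≤ lam := by
    rw [Real.le_logb_iff_rpow_le (by norm_num) (by linarith)]
    refine le_trans ?_ hℓ
    have : ((2 : ℝ) ^ (1 / 2 : ℝ)) ^ 2 = 2 := by
      rw [← Real.rpow_natCast, ← Real.rpow_mul (by norm_num)]
      norm_num
    nlinarith [Real.rpow_nonneg (show (0 : ℝ) ≤ 2 by norm_num) (1 / 2 : ℝ)]
  have hL := hclog m (by omega)
  refine ⟨by linarith, by linarith, Real.logb_nonneg (by norm_num) (by exact_mod_cast hn),
    by linarith, hclog n hn, ?_⟩
  have hu := hclog (2 * Nat.clog 2 m + 31) (by omega)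
  have h7 : Real.logb 2 ((2 * Nat.clog 2 m + 31 : ℕ) : ℝ) ≤ 7 + lam := by
    have h128 : (7 : ℝ) + lam = Real.logb 2 (2 ^ (7 : ℕ) * ℓ) := by
      rw [Real.logb_mul (by norm_num) (by linarith), Real.logb_pow,
        Real.logb_self_eq_one (by norm_num)]
      norm_num
      rfl
    rw [h128]
    refine Real.logb_le_logb_of_le (by norm_num) (by positivity) ?_
    push_cast
    linarith
  linarith

/-- The same quantities, when the universe has two elements. -/
lemma log_bounds_two {n : ℕ} (hn : 2 ≤ n) :
    1 ≤ Real.logb 2 n ∧ (Nat.clog 2 n : ℝ) ≤ 2 * Real.logb 2 n := by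
  have h1 : 1 ≤ Real.logb 2 n := by
    rw [Real.le_logb_iff_rpow_le (by norm_num) (by positivity), Real.rpow_one]
    exact_mod_cast hn
  have h := (Nat.ceil_lt_add_one (zero_le_one.trans h1)).le
  have h2 := Real.natCeil_logb_natCast 2 n
  rw [Nat.cast_ofNat] at h2
  rw [h2] at h
  exact ⟨h1, by linarith⟩

/-- The bounds for `m ≥ 3`; additive constants are absorbed since `log log m` is bounded below. -/
lemma resource_bounds {L c u ℓ lam ν : ℝ} (hL0 : 0 ≤ L) (hu0 : 0 ≤ u) (hl : 1 ≤ ℓ)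
    (hlam : 1 ≤ 2 * lam) (hν : 0 ≤ ν) (hLl : L ≤ 2 * ℓ) (hul : u ≤ 17 * lam)
    (hLc : L * c ≤ 2 * ℓ * (ν + 1)) :
    5 * (L * c) + 21184 * (L ^ 4 * u ^ 2) ≤ 10 ^ 8 * (ℓ * (ν + ℓ ^ 3 * lam ^ 2)) ∧
      516 * (L ^ 2 * u) + 11 * (L * c) ≤ 10 ^ 8 * (ℓ * (ν + ℓ * lam)) ∧
      20 * L ^ 2 ≤ 10 ^ 8 * ℓ ^ 2 := by
  have hlam0 : 0 ≤ lam := by linarith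
  have hℓ0 : 0 ≤ ℓ := by linarith
  have h5 : 0 ≤ ℓ * ν := by positivity
  refine ⟨?_, ?_, ?_⟩
  · have h1 : L ^ 4 * u ^ 2 ≤ (2 * ℓ) ^ 4 * (17 * lam) ^ 2 := by gcongr
    have h2 : 1 ≤ 4 * (ℓ ^ 3 * lam ^ 2) := by
      have : 1 ≤ ℓ ^ 3 := one_le_pow₀ hl
      nlinarith [mul_nonneg (sub_nonneg.mpr this) (sq_nonneg lam)]
    have h3 : ℓ ≤ ℓ * (4 * (ℓ ^ 3 * lam ^ 2)) := le_mul_of_one_le_right hℓ0 h2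
    have h6 : 0 ≤ ℓ * (ℓ ^ 3 * lam ^ 2) := by positivity
    linear_combination 5 * hLc + 21184 * h1 + 10 * h3 + (10 ^ 8 - 10) * h5 +
      (10 ^ 8 - 40 - 21184 * 4624) * h6
  · have h1 : L ^ 2 * u ≤ (2 * ℓ) ^ 2 * (17 * lam) := by gcongr
    have h2 : 1 ≤ 2 * (ℓ * lam) := by nlinarith
    have h3 : ℓ ≤ ℓ * (2 * (ℓ * lam)) := le_mul_of_one_le_right hℓ0 h2
    have h6 : 0 ≤ ℓ * (ℓ * lam) := by positivity
    linear_combination 516 * h1 + 11 * hLc + 22 * h3 + (10 ^ 8 - 22) * h5 +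
      (10 ^ 8 - 44 - 516 * 68) * h6
  · have h1 : L ^ 2 ≤ (2 * ℓ) ^ 2 := by gcongr
    linear_combination 20 * h1 + (10 ^ 8 - 80) * sq_nonneg ℓ

/-- The bounds for `m = 2`, where `L = 1` and `u ≤ 6`. -/
lemma resource_bounds_two {c u ν : ℝ} (hu0 : 0 ≤ u) (hu : u ≤ 6) (hν : 1 ≤ ν) (hc : c ≤ 2 * ν) :
    5 * (1 * c) + 21184 * (1 ^ 4 * u ^ 2) ≤ 10 ^ 8 * ν ∧
      516 * (1 ^ 2 * u) + 11 * (1 * c) ≤ 10 ^ 8 * ν := by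
  have h : u ^ 2 ≤ 36 := by nlinarith
  constructor <;> linarith

/-- The verifier, with bounds in terms of `L = ⌈log₂ m⌉`. -/
lemma exists_verifier {m n L u : ℕ} (hn : 1 ≤ n) (hL : 0 < L) (hmL : m ≤ 2 ^ L)
    (hudef : u = Nat.clog 2 (2 * L + 31)) :
    ∃ V : SIPVerifier m L,
      V.Computes (fun σ : Fin n → Fin m => distinctElements σ) (1 / 6) (1 / 3) ∧
      V.communication ≤ 5 * (L * Nat.clog 2 n) + 21184 * (L ^ 4 * u ^ 2) ∧
      V.space ≤ 516 * (L ^ 2 * u) + 11 * (L * Nat.clog 2 n) ∧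
      ∀ C, 112 ≤ C → V.UpdateTimeLE n ((L + 1) ^ C) (20 * L ^ 2) := by
  generalize hc : Nat.clog 2 n = c
  have hu : 2 * L + 31 ≤ 2 ^ u := hudef ▸ Nat.le_pow_clog (by norm_num) _
  have huL : u ≤ 2 * L + 31 := hudef ▸ Nat.clog_le_of_le_pow Nat.lt_two_pow_self.le
  have hu1 : 1 ≤ u := by
    by_contra! h
    rw [Nat.lt_one_iff.mp h] at hu
    omega
  obtain ⟨S, hA, hB, hD, hK⟩ := exists_sketchSetup hn hL hmL hu huL
  have hcomm : S.verifier.communication ≤ 5 * (L * c) + 21184 * (L ^ 4 * u ^ 2) := by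
    refine S.communication_le.trans ?_
    rw [hA, hB, hD, hc]
    have h1 : L * (16 * u + 16) ≤ 32 * (L * u) := by nlinarith
    have h2 : (2 * L + 3) * (4 * (2 * L + 31) * u) + 2 ≤ 662 * (L * L * u) := by
      have : (2 * L + 3) * (4 * (2 * L + 31) * u) ≤ (5 * L) * (4 * (33 * L) * u) := by
        gcongr <;> omega
      nlinarith [Nat.mul_pos (Nat.mul_pos hL hL) hu1]
    calc _ ≤ (5 * L) * c + L * (32 * (L * u) * (662 * (L * L * u))) := by
          gcongr
          omega
      _ = _ := by ring
  have hspace : S.verifier.space ≤ 516 * (L ^ 2 * u) + 11 * (L * c) := by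
    refine S.space_le.trans ?_
    rw [hA, hB, hc]
    have h1 : L * (16 * u + 16) ≤ 32 * (L * u) := by nlinarith
    have h2 : L * (16 * u + 16) * (2 * L + (2 * L + 3) + 9) ≤ 32 * (L * u) * (16 * L) := by
      gcongr
      omega
    have h3 : L ≤ L ^ 2 * u := by nlinarith [Nat.mul_pos hL hL]
    have h4 : c ≤ L * c := Nat.le_mul_of_pos_left c hL
    nlinarith
  have htime : L * (1 + 3 * L + 3 * (2 * L + 3)) + 1 ≤ 20 * L ^ 2 := by nlinarith
  have hw : ∀ C, 112 ≤ C → ∀ i, Fintype.card (S.K i) ≤ (L + 1) ^ C := by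
    intro C hC i
    have h6 : 2 * L + 31 ≤ (L + 1) ^ 6 := by
      calc 2 * L + 31 ≤ 2 ^ 5 * (L + 1) := by omega
        _ ≤ (L + 1) ^ 5 * (L + 1) := Nat.mul_le_mul_right _ (Nat.pow_le_pow_left (by omega) 5)
        _ = _ := by ring
    have h4 : 4 ≤ (L + 1) ^ 2 := by nlinarith
    calc _ ≤ (4 * (2 * L + 31) * u) ^ 8 := hK i
      _ ≤ ((L + 1) ^ 2 * (L + 1) ^ 6 * (L + 1) ^ 6) ^ 8 := by
          gcongr
          exact huL.trans h6
      _ = (L + 1) ^ 112 := by ring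
      _ ≤ (L + 1) ^ C := Nat.pow_le_pow_right (by omega) hC
  exact ⟨S.verifier, S.computes, hcomm, hspace, fun C hC => S.updateTimeLE (hw C hC) htime⟩

theorem mainTheorem1 :
    ∃ C : ℕ, ∀ m n : ℕ, 2 ≤ m → 1 ≤ n → ¬ (m = 2 ∧ n = 1) →
      ∃ V : SIPVerifier m (Nat.clog 2 m),
        V.Computes (fun σ : Fin n → Fin m => distinctElements σ) (1 / 6) (1 / 3) ∧
        (V.communication : ℝ) ≤
          C * (Real.logb 2 m *
            (Real.logb 2 n + Real.logb 2 m ^ 3 * Real.logb 2 (Real.logb 2 m) ^ 2)) ∧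
        (V.space : ℝ) ≤
          C * (Real.logb 2 m *
            (Real.logb 2 n + Real.logb 2 m * Real.logb 2 (Real.logb 2 m))) ∧
        ∃ T : ℕ, (T : ℝ) ≤ C * Real.logb 2 m ^ 2 ∧
          V.UpdateTimeLE n ((Nat.clog 2 m + 1) ^ C) T := by
  obtain ⟨C, hC⟩ : ∃ C : ℕ, 10 ^ 8 ≤ C := ⟨_, le_rfl⟩
  refine ⟨C, fun m n hm hn hmn => ?_⟩
  have hCR : (10 ^ 8 : ℝ) ≤ C := by exact_mod_cast hC
  obtain ⟨L, hLdef⟩ : ∃ L, L = Nat.clog 2 m := ⟨_, rfl⟩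
  obtain ⟨u, hudef⟩ : ∃ u, u = Nat.clog 2 (2 * L + 31) := ⟨_, rfl⟩
  have hL : 0 < L := hLdef ▸ Nat.clog_pos (by norm_num) hm
  have hmL : m ≤ 2 ^ L := hLdef ▸ Nat.le_pow_clog (by norm_num) m
  obtain ⟨V, hV, hcomm, hspace, htime⟩ := exists_verifier hn hL hmL hudef
  rw [← hLdef]
  generalize hc : Nat.clog 2 n = c at hcomm hspace
  have hcommR : (V.communication : ℝ) ≤ 5 * (L * c) + 21184 * (L ^ 4 * u ^ 2) := by
    exact_mod_cast hcomm
  have hspaceR : (V.space : ℝ) ≤ 516 * (L ^ 2 * u) + 11 * (L * c) := by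
    exact_mod_cast hspace
  refine ⟨V, hV, ?_⟩
  suffices h : (V.communication : ℝ) ≤ C * (Real.logb 2 m *
      (Real.logb 2 n + Real.logb 2 m ^ 3 * Real.logb 2 (Real.logb 2 m) ^ 2)) ∧
      (V.space : ℝ) ≤ C * (Real.logb 2 m *
        (Real.logb 2 n + Real.logb 2 m * Real.logb 2 (Real.logb 2 m))) ∧
      (20 * L ^ 2 : ℝ) ≤ C * Real.logb 2 m ^ 2 from
    ⟨h.1, h.2.1, 20 * L ^ 2, by exact_mod_cast h.2.2, htime C (le_trans (by norm_num) hC)⟩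
  rcases hm.eq_or_lt with rfl | hm3
  -- for `m = 2` the terms with `log log m` vanish, but then `n ≥ 2`, and everything but `log n` is
  -- bounded
  · obtain ⟨h1, h2⟩ := log_bounds_two (n := n) (by omega)
    have hL1 : L = 1 := hLdef
    have hL1R : (L : ℝ) = 1 := by exact_mod_cast hL1
    have hu6 : u ≤ 6 := by
      rw [hudef, hL1]
      exact Nat.clog_le_of_le_pow (by norm_num)
    have huR : (u : ℝ) ≤ 6 := by exact_mod_cast hu6
    rw [hc] at h2
    obtain ⟨h3, h4⟩ := resource_bounds_two (Nat.cast_nonneg u) huR h1 h2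
    rw [hL1R] at hcommR hspaceR ⊢
    rw [Nat.cast_ofNat, Real.logb_self_eq_one one_lt_two, Real.logb_one]
    have hν : 0 ≤ Real.logb 2 n := zero_le_one.trans h1
    have h5 := mul_le_mul_of_nonneg_right hCR hν
    refine ⟨(hcommR.trans h3).trans (h5.trans_eq (by ring)),
      (hspaceR.trans h4).trans (h5.trans_eq (by ring)), le_trans ?_ (hCR.trans_eq (by ring))⟩
    norm_num
  · obtain ⟨hl, hlam, hν, hLl, hcν, hul⟩ := log_bounds hm3 hn
    rw [← hLdef] at hLl hul
    rw [← hudef] at hul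
    rw [hc] at hcν
    set ℓ := Real.logb 2 m
    set lam := Real.logb 2 ℓ
    set ν := Real.logb 2 n
    have hL0 : (0 : ℝ) ≤ L := Nat.cast_nonneg L
    have hu0 : (0 : ℝ) ≤ u := Nat.cast_nonneg u
    have hlam0 : 0 ≤ lam := by linarith
    have hLc : (L : ℝ) * c ≤ 2 * ℓ * (ν + 1) :=
      mul_le_mul hLl hcν (Nat.cast_nonneg c) (by linarith)
    obtain ⟨h1, h2, h3⟩ := resource_bounds hL0 hu0 hl hlam hν hLl hul hLc
    have hℓ0 : 0 ≤ ℓ := zero_le_one.trans hl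
    exact ⟨(hcommR.trans h1).trans (mul_le_mul_of_nonneg_right hCR (by positivity)),
      (hspaceR.trans h2).trans (mul_le_mul_of_nonneg_right hCR (by positivity)),
      h3.trans (mul_le_mul_of_nonneg_right hCR (sq_nonneg ℓ))⟩
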